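/- Let $C(S_4^+)$ be the universal unital $C^*$-algebra generated by elements $u_{ij}$ ($1\le i,j\le 4$) subject to the relations $$u_{ij}^2=u_{ij}^*=u_{ij},\qquad \sum_{k=1}^4 u_{ik}=1,\qquad \sum_{k=1}^4 u_{kj}=1\qquad(1\le i,j\le 4),$$ and let $u=(u_{ij})$. Let $A$ be the universal unital $C^*$-algebra generated by two projections $p$ and $q$ (that is, $p^2=p^*=p$ and $q^2=q^*=q$), and let $$R=\begin{pmatrix} p&0&1-p&0\\ 1-p&0&p&0\\ 0&q&0&1-q\\ 0&1-q&0&q\end{pmatrix}\in M_4(A).$$ Let $M\in M_4(A\otimes A\otimes A)$ be the matrix with entries $$M_{ij}=\sum_{k,l=1}^4 R_{ik}\otimes R_{kl}\otimes R_{lj}\qquad(1\le i,j\le 4),$$ where $\otimes$ is the (maximal) $C^*$-tensor product. Let $P\in\mathbb C\langle x_{ij}: 1\le i,j\le 4\rangle$ be a noncommutative polynomial (an element of the free unital complex algebra on the $16$ variables $x_{ij}$) of degree at most $50$, and let $P(M)$ and $P(u)$ be obtained from $P$ by substituting $x_{ij}\mapsto M_{ij}$ and $x_{ij}\mapsto u_{ij}$,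 respectively. Then $P(M)=0$ if and only if $P(u)=0$. -/

import Mathlib

open scoped TensorProduct

noncomputable section

namespace QPerm

/-! ### C*-seminorms and the enveloping C*-algebra of a family of C*-seminorms -/

/-- A C*-seminorm on a unital complex *-algebra: a submultiplicative seminorm that satisfies
the C*-identity. -/
structure CStarSeminorm (F : Type*) [Ring F] [StarRing F] [Algebra ℂ F] extends
    Seminorm ℂ F where
  mul_le' : ∀ x y : F, toFun (x * y) ≤ toFun x * toFun y
  star_mul_self' : ∀ x : F, toFun (star x * x) = toFun x ^ 2

namespace CStarSeminorm

variable {F : Type*} [Ring F] [StarRing F] [Algebra ℂ F]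

instance : CoeFun (CStarSeminorm F) (fun _ => F → ℝ) := ⟨fun p => p.toFun⟩

variable (p : CStarSeminorm F)

theorem nonneg (x : F) : 0 ≤ p x := apply_nonneg p.toSeminorm x

theorem zero_eq : p 0 = 0 := map_zero p.toSeminorm

theorem add_le (x y : F) : p (x + y) ≤ p x + p y := map_add_le_add p.toSeminorm x y

theorem neg_eq (x : F) : p (-x) = p x := map_neg_eq_map p.toSeminorm x

theorem smul_eq (c : ℂ) (x : F) : p (c • x) = ‖c‖ * p x := map_smul_eq_mul p.toSeminorm c x

theorem mul_le (x y : F) : p (x * y) ≤ p x * p y := p.mul_le' x y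

theorem star_mul_self (x : F) : p (star x * x) = p x ^ 2 := p.star_mul_self' x

theorem le_star (x : F) : p x ≤ p (star x) := by
  have h1 := p.star_mul_self x
  have h2 := p.mul_le (star x) x
  have h3 := p.nonneg x
  have h4 := p.nonneg (star x)
  by_contra! h
  nlinarith

theorem star_eq (x : F) : p (star x) = p x :=
  le_antisymm (by simpa using p.le_star (star x)) (p.le_star x)

theorem one_le : p 1 ≤ 1 := by
  have h1 := p.star_mul_self 1
  have h3 := p.nonneg 1
  simp only [star_one, mul_one] at h1
  by_contra! h
  nlinarith

end CStarSeminorm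

/-- A family of C*-seminorms that is pointwise bounded. -/
structure BoundedFamily (F : Type*) [Ring F] [StarRing F] [Algebra ℂ F] where
  carrier : Set (CStarSeminorm F)
  bdd : ∀ x : F, ∃ C : ℝ, ∀ p ∈ carrier, p x ≤ C

namespace BoundedFamily

section
variable {F : Type*} [Ring F] [StarRing F] [Algebra ℂ F] (S : BoundedFamily F)

/-- The supremum of a pointwise bounded family of C*-seminorms. -/
def sup (x : F) : ℝ := ⨆ p : S.carrier, p.1 x

theorem le_sup {p : CStarSeminorm F} (hp : p ∈ S.carrier) (x : F) : p x ≤ S.sup x := by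
  obtain ⟨C, hC⟩ := S.bdd x
  exact le_ciSup (f := fun p : S.carrier => p.1 x)
    ⟨C, by rintro _ ⟨q, rfl⟩; exact hC q.1 q.2⟩ ⟨p, hp⟩

theorem sup_nonneg (x : F) : 0 ≤ S.sup x := Real.iSup_nonneg fun p => p.1.nonneg x

theorem sup_le {x : F} {C : ℝ} (hC : 0 ≤ C) (h : ∀ p ∈ S.carrier, p x ≤ C) : S.sup x ≤ C :=
  Real.iSup_le (fun p => h p.1 p.2) hC

/-- The *-algebra `F`, regarded as seminormed by the supremum of the family. -/
def Pre (_S : BoundedFamily F) : Type _ := F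

instance : Ring S.Pre := inferInstanceAs (Ring F)
instance : StarRing S.Pre := inferInstanceAs (StarRing F)
instance : Algebra ℂ S.Pre := inferInstanceAs (Algebra ℂ F)

instance instSeminormedAddCommGroup : SeminormedAddCommGroup S.Pre :=
  AddGroupSeminorm.toSeminormedAddCommGroup
    { toFun := fun x : S.Pre => S.sup x
      map_zero' := le_antisymm (S.sup_le le_rfl fun p _ => p.zero_eq.le) (S.sup_nonneg _)
      add_le' := fun _ _ => S.sup_le (add_nonneg (S.sup_nonneg _) (S.sup_nonneg _)) fun p hp =>
        (p.add_le _ _).trans (add_le_add (S.le_sup hp _) (S.le_sup hp _))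
      neg' := fun x => congrArg iSup (funext fun p => p.1.neg_eq x) }

theorem norm_def (x : S.Pre) : ‖x‖ = S.sup x := rfl

instance : SeminormedRing S.Pre where
  __ := instSeminormedAddCommGroup S
  __ := (inferInstance : Ring S.Pre)
  norm_mul_le _ _ := S.sup_le (mul_nonneg (S.sup_nonneg _) (S.sup_nonneg _)) fun p hp =>
    (p.mul_le _ _).trans
      (mul_le_mul (S.le_sup hp _) (S.le_sup hp _) (p.nonneg _) (S.sup_nonneg _))

instance : NormedAlgebra ℂ S.Pre where
  norm_smul_le c x := S.sup_le (mul_nonneg (norm_nonneg _) (S.sup_nonneg _)) fun p hp =>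
    (p.smul_eq c x).le.trans (mul_le_mul_of_nonneg_left (S.le_sup hp _) (norm_nonneg _))

theorem norm_star_pre (x : S.Pre) : ‖star x‖ = ‖x‖ :=
  congrArg iSup (funext fun p => p.1.star_eq x)

theorem norm_sq_le (x : S.Pre) : ‖x‖ * ‖x‖ ≤ ‖star x * x‖ := by
  have h : ‖x‖ ≤ √‖star x * x‖ := S.sup_le (Real.sqrt_nonneg _) fun p hp =>
    Real.le_sqrt_of_sq_le ((p.star_mul_self x).symm.le.trans (S.le_sup hp _))
  calc ‖x‖ * ‖x‖ ≤ √‖star x * x‖ * √‖star x * x‖ :=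
        mul_le_mul h h (norm_nonneg _) (Real.sqrt_nonneg _)
    _ = ‖star x * x‖ := Real.mul_self_sqrt (norm_nonneg _)

theorem uniformContinuous_star : UniformContinuous (star : S.Pre → S.Pre) :=
  (Isometry.of_dist_eq fun x y => by
    rw [dist_eq_norm, dist_eq_norm, ← star_sub, norm_star_pre]).uniformContinuous

/-- The enveloping C*-algebra of a pointwise bounded family of C*-seminorms: the Hausdorff
completion of the *-algebra for the supremum of the family, that is, the completion of the
quotient by the elements of seminorm zero. -/
def Envelope : Type _ := UniformSpace.Completion S.Pre

instance : NormedRing S.Envelope := inferInstanceAs (NormedRing (UniformSpace.Completion S.Pre))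

instance : CompleteSpace S.Envelope :=
  inferInstanceAs (CompleteSpace (UniformSpace.Completion S.Pre))

instance : Algebra ℂ S.Envelope := inferInstanceAs (Algebra ℂ (UniformSpace.Completion S.Pre))

/-- The canonical map from the *-algebra to its envelope. -/
def toEnvelope (x : F) : S.Envelope :=
  ((show S.Pre from x : S.Pre) : UniformSpace.Completion S.Pre)

theorem toEnvelope_add (x y : F) : S.toEnvelope (x + y) = S.toEnvelope x + S.toEnvelope y :=
  UniformSpace.Completion.coe_add (α := S.Pre) x y

theorem toEnvelope_mul (x y : F) : S.toEnvelope (x * y) = S.toEnvelope x * S.toEnvelope y :=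
  UniformSpace.Completion.coe_mul (α := S.Pre) x y

theorem norm_toEnvelope (x : F) : ‖S.toEnvelope x‖ = S.sup x :=
  UniformSpace.Completion.norm_coe (E := S.Pre) x

theorem envelope_induction {q : S.Envelope → Prop} (x : S.Envelope)
    (hq : IsClosed {x | q x}) (h : ∀ y : F, q (S.toEnvelope y)) : q x :=
  UniformSpace.Completion.induction_on x hq h

instance : NormedAlgebra ℂ S.Envelope where
  norm_smul_le c x :=
    norm_smul_le (α := ℂ) (β := UniformSpace.Completion S.Pre) c x

instance : Star S.Envelope := ⟨UniformSpace.Completion.map (star : S.Pre → S.Pre)⟩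

theorem star_toEnvelope (x : F) : star (S.toEnvelope x) = S.toEnvelope (star x) :=
  UniformSpace.Completion.map_coe (α := S.Pre) S.uniformContinuous_star x

theorem continuous_star_envelope : Continuous (star : S.Envelope → S.Envelope) :=
  UniformSpace.Completion.continuous_map

instance : StarRing S.Envelope where
  star_involutive x := by
    refine S.envelope_induction (q := fun x => star (star x) = x) x (isClosed_eq
      (S.continuous_star_envelope.comp S.continuous_star_envelope) continuous_id) fun y => ?_
    rw [star_toEnvelope, star_toEnvelope, star_star]
  star_mul x y := by
    have hs := S.continuous_star_envelope
    refine S.envelope_induction (q := fun x => star (x * y) = star y * star x) x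
      (isClosed_eq (hs.comp (continuous_mul_const y))
      ((continuous_const_mul (star y)).comp hs)) fun a => ?_
    refine S.envelope_induction
      (q := fun y => star (S.toEnvelope a * y) = star y * star (S.toEnvelope a)) y
      (isClosed_eq (hs.comp (continuous_const_mul _))
      ((continuous_mul_const _).comp hs)) fun b => ?_
    rw [← toEnvelope_mul, star_toEnvelope, star_mul, toEnvelope_mul, star_toEnvelope,
      star_toEnvelope]
  star_add x y := by
    have hs := S.continuous_star_envelope
    refine S.envelope_induction (q := fun x => star (x + y) = star x + star y) x
      (isClosed_eq (hs.comp (continuous_add_const y))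
      ((continuous_add_const (star y)).comp hs)) fun a => ?_
    refine S.envelope_induction
      (q := fun y => star (S.toEnvelope a + y) = star (S.toEnvelope a) + star y) y
      (isClosed_eq (hs.comp (continuous_const_add _))
      ((continuous_const_add _).comp hs)) fun b => ?_
    rw [← toEnvelope_add, star_toEnvelope, star_add, toEnvelope_add, star_toEnvelope,
      star_toEnvelope]

instance : CStarRing S.Envelope where
  norm_mul_self_le x := by
    have hs := S.continuous_star_envelope
    refine S.envelope_induction (q := fun x => ‖x‖ * ‖x‖ ≤ ‖star x * x‖) x (isClosed_le (continuous_norm.mul continuous_norm)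
      (continuous_norm.comp (hs.mul continuous_id))) fun a => ?_
    rw [star_toEnvelope, ← toEnvelope_mul, norm_toEnvelope, norm_toEnvelope]
    exact S.norm_sq_le a

theorem toEnvelope_smul (c : ℂ) (x : F) : S.toEnvelope (c • x) = c • S.toEnvelope x :=
  UniformSpace.Completion.coe_smul (X := S.Pre) c x

end

section
variable {F : Type*} [Ring F] [StarRing F] [Algebra ℂ F] [StarModule ℂ F] (S : BoundedFamily F)

instance : StarModule ℂ S.Envelope where
  star_smul c x := by
    have hs := S.continuous_star_envelope
    refine S.envelope_induction (q := fun x => star (c • x) = star c • star x) x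
      (isClosed_eq (hs.comp (continuous_const_smul c))
      ((continuous_const_smul (star c)).comp hs)) fun a => ?_
    rw [← toEnvelope_smul, star_toEnvelope, star_smul, toEnvelope_smul, star_toEnvelope]

instance : CStarAlgebra S.Envelope where

end

end BoundedFamily

/-! ### Universal C*-algebras given by generators and relations -/

/-- The free unital complex *-algebra on `E`: noncommutative polynomials in the letters
`inl e` (the generator `e`) and `inr e` (its adjoint `e*`). -/
def FreeStarAlgebra (E : Type*) : Type _ := FreeAlgebra ℂ (E ⊕ E)

namespace FreeStarAlgebra

variable {E : Type*}

instance : Ring (FreeStarAlgebra E) := inferInstanceAs (Ring (FreeAlgebra ℂ (E ⊕ E)))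

instance : Algebra ℂ (FreeStarAlgebra E) := inferInstanceAs (Algebra ℂ (FreeAlgebra ℂ (E ⊕ E)))

/-- A letter of the free *-algebra. -/
def letter (e : E ⊕ E) : FreeStarAlgebra E := FreeAlgebra.ι ℂ e

/-- The generator attached to `e`. -/
def gen (e : E) : FreeStarAlgebra E := letter (Sum.inl e)

theorem induction {q : FreeStarAlgebra E → Prop} (h1 : ∀ c : ℂ, q (algebraMap ℂ _ c))
    (h2 : ∀ e, q (letter e)) (h3 : ∀ x y, q x → q y → q (x * y))
    (h4 : ∀ x y, q x → q y → q (x + y)) (x : FreeStarAlgebra E) : q x :=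
  FreeAlgebra.induction (R := ℂ) (X := E ⊕ E) (motive := q) h1 h2 (fun x y hx hy => h3 x y hx hy)
    (fun x y hx hy => h4 x y hx hy) x

/-- The conjugate-linear antihomomorphism that exchanges each generator with its adjoint, as a
ring homomorphism into the opposite ring. -/
def starAux (E : Type*) : FreeStarAlgebra E →+* (FreeStarAlgebra E)ᵐᵒᵖ :=
  letI : Algebra ℂ (FreeStarAlgebra E)ᵐᵒᵖ :=
    Algebra.compHom (FreeStarAlgebra E)ᵐᵒᵖ (starRingEnd ℂ)
  (FreeAlgebra.lift ℂ fun e : E ⊕ E =>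
    MulOpposite.op (letter e.swap) : FreeAlgebra ℂ (E ⊕ E) →ₐ[ℂ] (FreeStarAlgebra E)ᵐᵒᵖ).toRingHom

theorem starAux_letter (e : E ⊕ E) : starAux E (letter e) = MulOpposite.op (letter e.swap) := by
  let _ : Algebra ℂ (FreeStarAlgebra E)ᵐᵒᵖ :=
    Algebra.compHom (FreeStarAlgebra E)ᵐᵒᵖ (starRingEnd ℂ)
  exact FreeAlgebra.lift_ι_apply
    (fun e : E ⊕ E => (MulOpposite.op (letter e.swap) : (FreeStarAlgebra E)ᵐᵒᵖ)) e

theorem starAux_algebraMap (c : ℂ) :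
    starAux E (algebraMap ℂ _ c) = MulOpposite.op (algebraMap ℂ _ (starRingEnd ℂ c)) := by
  let _ : Algebra ℂ (FreeStarAlgebra E)ᵐᵒᵖ :=
    Algebra.compHom (FreeStarAlgebra E)ᵐᵒᵖ (starRingEnd ℂ)
  exact (FreeAlgebra.lift ℂ fun e : E ⊕ E =>
    (MulOpposite.op (letter e.swap) : (FreeStarAlgebra E)ᵐᵒᵖ)).commutes c

instance : Star (FreeStarAlgebra E) := ⟨fun x => (starAux E x).unop⟩

theorem star_def (x : FreeStarAlgebra E) : star x = (starAux E x).unop := rfl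

theorem star_letter (e : E ⊕ E) : star (letter e) = letter e.swap := by
  rw [star_def, starAux_letter, MulOpposite.unop_op]

theorem star_algebraMap (c : ℂ) :
    star (algebraMap ℂ (FreeStarAlgebra E) c) = algebraMap ℂ _ (starRingEnd ℂ c) := by
  rw [star_def, starAux_algebraMap, MulOpposite.unop_op]

theorem star_mul' (x y : FreeStarAlgebra E) : star (x * y) = star y * star x := by
  simp only [star_def, map_mul, MulOpposite.unop_mul]

theorem star_add' (x y : FreeStarAlgebra E) : star (x + y) = star x + star y := by
  simp only [star_def, map_add, MulOpposite.unop_add]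

instance : StarRing (FreeStarAlgebra E) where
  star_involutive x := by
    refine induction (q := fun x => star (star x) = x) (fun c => ?_) (fun e => ?_)
      (fun x y hx hy => ?_) (fun x y hx hy => ?_) x
    · rw [star_algebraMap, star_algebraMap, Complex.conj_conj]
    · rw [star_letter, star_letter, Sum.swap_swap]
    · rw [star_mul', star_mul', hx, hy]
    · rw [star_add', star_add', hx, hy]
  star_mul := star_mul'
  star_add := star_add'

instance : StarModule ℂ (FreeStarAlgebra E) where
  star_smul c x := by
    rw [Algebra.smul_def, star_mul', star_algebraMap, Algebra.smul_def, Algebra.commutes]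
    rfl

end FreeStarAlgebra

/-- Generators and relations for a unital C*-algebra: a set of noncommutative *-polynomials
(each one to be read as the relation that it equals zero) such that the C*-seminorms on the free
*-algebra that vanish on it are pointwise bounded, which is the condition for the universal
C*-algebra to exist. -/
structure Presentation (E : Type*) where
  rel : Set (FreeStarAlgebra E)
  bdd : ∀ x : FreeStarAlgebra E, ∃ C : ℝ, ∀ p : CStarSeminorm (FreeStarAlgebra E),
    (∀ r ∈ rel, p r = 0) → p x ≤ C

namespace Presentation

variable {E : Type*}

/-- The C*-seminorms that vanish on the relations. -/
def family (R : Presentation E) : BoundedFamily (FreeStarAlgebra E) where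
  carrier := {p | ∀ r ∈ R.rel, p r = 0}
  bdd := R.bdd

/-- The universal unital C*-algebra `C*(E | R)`: the Hausdorff completion of the free *-algebra
on `E` for the largest C*-seminorm that vanishes on the relations. -/
abbrev Universal (R : Presentation E) : Type _ := R.family.Envelope

/-- The canonical generators of `C*(E | R)`. -/
def gen (R : Presentation E) (e : E) : R.Universal :=
  R.family.toEnvelope (FreeStarAlgebra.gen e)

/-- If the relations make every generator a projection, then the boundedness condition holds. -/
theorem bdd_of_projections (rel : Set (FreeStarAlgebra E))
    (h1 : ∀ e : E, FreeStarAlgebra.gen e * FreeStarAlgebra.gen e - FreeStarAlgebra.gen e ∈ rel)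
    (h2 : ∀ e : E, star (FreeStarAlgebra.gen e) - FreeStarAlgebra.gen e ∈ rel)
    (x : FreeStarAlgebra E) : ∃ C : ℝ, ∀ p : CStarSeminorm (FreeStarAlgebra E),
      (∀ r ∈ rel, p r = 0) → p x ≤ C := by
  refine FreeStarAlgebra.induction (q := fun x => ∃ C : ℝ,
    ∀ p : CStarSeminorm (FreeStarAlgebra E), (∀ r ∈ rel, p r = 0) → p x ≤ C)
    (fun c => ⟨‖c‖, fun p _ => ?_⟩) (fun e => ⟨1, fun p hp => ?_⟩) ?_ ?_ x
  · rw [Algebra.algebraMap_eq_smul_one, p.smul_eq]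
    exact mul_le_of_le_one_right (norm_nonneg _) p.one_le
  · have key : ∀ e : E, p (FreeStarAlgebra.gen e) ≤ 1 := by
      intro e
      have ha := hp _ (h1 e)
      have hb := hp _ (h2 e)
      generalize FreeStarAlgebra.gen e = g at ha hb
      have hg : star g * g = (star g - g) * g + (g * g - g) + g := by noncomm_ring
      have h3 := p.star_mul_self g
      have h4 := p.add_le ((star g - g) * g + (g * g - g)) g
      have h5 := p.add_le ((star g - g) * g) (g * g - g)
      have h6 := p.mul_le (star g - g) g
      rw [hb, zero_mul] at h6
      rw [ha] at h5
      rw [hg] at h3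
      by_contra! h
      nlinarith
    rcases e with e | e
    · exact key e
    · have h := p.star_eq (FreeStarAlgebra.gen e)
      rw [FreeStarAlgebra.gen, FreeStarAlgebra.star_letter] at h
      exact h.le.trans (key e)
  · rintro x y ⟨C, hC⟩ ⟨D, hD⟩
    exact ⟨|C| * |D|, fun p hp => (p.mul_le x y).trans
      (mul_le_mul ((hC p hp).trans (le_abs_self _)) ((hD p hp).trans (le_abs_self _))
        (p.nonneg _) (abs_nonneg _))⟩
  · rintro x y ⟨C, hC⟩ ⟨D, hD⟩
    exact ⟨C + D, fun p hp => (p.add_le x y).trans (add_le_add (hC p hp) (hD p hp))⟩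

end Presentation

/-! ### The quantum permutation group -/

section
open FreeStarAlgebra

/-- The relations `x_ij² = x_ij* = x_ij`, `∑ₖ x_ik = 1` and `∑ₖ x_kj = 1` of an `n × n` magic
unitary. -/
def magicRel (n : ℕ) : Set (FreeStarAlgebra (Fin n × Fin n)) :=
  {r | (∃ i j, r = gen (i, j) * gen (i, j) - gen (i, j)) ∨
    (∃ i j, r = star (gen (i, j)) - gen (i, j)) ∨
    (∃ i, r = ∑ k, gen (i, k) - 1) ∨
    (∃ j, r = ∑ k, gen (k, j) - 1)}

/-- The universal magic unitary presentation. -/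
def magicPresentation (n : ℕ) : Presentation (Fin n × Fin n) where
  rel := magicRel n
  bdd := Presentation.bdd_of_projections _ (fun e => Or.inl ⟨e.1, e.2, rfl⟩)
    (fun e => Or.inr (Or.inl ⟨e.1, e.2, rfl⟩))

/-- The C*-algebra `C(S_n⁺)` of the quantum permutation group. -/
abbrev QuantumPerm (n : ℕ) : Type := (magicPresentation n).Universal

/-- The matrix `u` of the generators of `C(S_n⁺)`. -/
def u (n : ℕ) : Matrix (Fin n) (Fin n) (QuantumPerm n) :=
  Matrix.of fun i j => (magicPresentation n).gen (i, j)

/-! ### The universal C*-algebra of two projections -/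

/-- The relations `x² = x* = x` for two generators. -/
def twoProjRel : Set (FreeStarAlgebra (Fin 2)) :=
  {r | (∃ i, r = gen i * gen i - gen i) ∨ (∃ i, r = star (gen i) - gen i)}

/-- The presentation by two projections. -/
def twoProjPresentation : Presentation (Fin 2) where
  rel := twoProjRel
  bdd := Presentation.bdd_of_projections _ (fun e => Or.inl ⟨e, rfl⟩) (fun e => Or.inr ⟨e, rfl⟩)

/-- The universal unital C*-algebra `A` generated by two projections. -/
abbrev TwoProj : Type := twoProjPresentation.Universal

/-- The first generating projection of `A`. -/
def p : TwoProj := twoProjPresentation.gen 0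

/-- The second generating projection of `A`. -/
def q : TwoProj := twoProjPresentation.gen 1

end

/-! ### Tensor products of C*-algebras -/

/-- Every C*-seminorm on a C*-algebra is dominated by the norm. -/
theorem CStarSeminorm.le_norm {A : Type*} [CStarAlgebra A] (s : CStarSeminorm A) (a : A) :
    s a ≤ ‖a‖ := by
  let S : BoundedFamily A := ⟨{s}, fun x => ⟨s x, by rintro _ rfl; exact le_rfl⟩⟩
  let f : A →⋆ₙₐ[ℂ] S.Envelope :=
    { toFun := S.toEnvelope
      map_smul' := S.toEnvelope_smul
      map_zero' := by
        have h := S.toEnvelope_add 0 0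
        simpa using h
      map_add' := S.toEnvelope_add
      map_mul' := S.toEnvelope_mul
      map_star' := fun x => (S.star_toEnvelope x).symm }
  have h1 : ‖f a‖ ≤ ‖a‖ := NonUnitalStarAlgHom.norm_apply_le f a
  exact ((S.le_sup rfl a).trans (S.norm_toEnvelope a).symm.le).trans h1

/-- All C*-seminorms on the algebraic tensor product of two C*-algebras. -/
def tensorFamily (A B : Type*) [CStarAlgebra A] [CStarAlgebra B] : BoundedFamily (A ⊗[ℂ] B) where
  carrier := Set.univ
  bdd x := by
    induction x using TensorProduct.induction_on with
    | zero => exact ⟨0, fun s _ => s.zero_eq.le⟩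
    | tmul a b =>
      refine ⟨‖a‖ * ‖b‖, fun s _ => ?_⟩
      let s₁ : CStarSeminorm A :=
        { toSeminorm := s.toSeminorm.comp
            (Algebra.TensorProduct.includeLeft : A →ₐ[ℂ] A ⊗[ℂ] B).toLinearMap
          mul_le' := fun x y => by
            have h := s.mul_le (x ⊗ₜ[ℂ] (1 : B)) (y ⊗ₜ[ℂ] (1 : B))
            rw [Algebra.TensorProduct.tmul_mul_tmul, one_mul] at h
            exact h
          star_mul_self' := fun x => by
            have h := s.star_mul_self (x ⊗ₜ[ℂ] (1 : B))
            rw [TensorProduct.star_tmul, Algebra.TensorProduct.tmul_mul_tmul, star_one,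
              one_mul] at h
            exact h }
      let s₂ : CStarSeminorm B :=
        { toSeminorm := s.toSeminorm.comp
            (Algebra.TensorProduct.includeRight : B →ₐ[ℂ] A ⊗[ℂ] B).toLinearMap
          mul_le' := fun x y => by
            have h := s.mul_le ((1 : A) ⊗ₜ[ℂ] x) ((1 : A) ⊗ₜ[ℂ] y)
            rw [Algebra.TensorProduct.tmul_mul_tmul, one_mul] at h
            exact h
          star_mul_self' := fun x => by
            have h := s.star_mul_self ((1 : A) ⊗ₜ[ℂ] x)
            rw [TensorProduct.star_tmul, Algebra.TensorProduct.tmul_mul_tmul, star_one,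
              one_mul] at h
            exact h }
      have h := s.mul_le (a ⊗ₜ[ℂ] (1 : B)) ((1 : A) ⊗ₜ[ℂ] b)
      rw [Algebra.TensorProduct.tmul_mul_tmul, one_mul, mul_one] at h
      exact h.trans (mul_le_mul (s₁.le_norm a) (s₂.le_norm b) (s.nonneg _) (norm_nonneg _))
    | add x y hx hy =>
      obtain ⟨C, hC⟩ := hx
      obtain ⟨D, hD⟩ := hy
      exact ⟨C + D, fun s hs => (s.add_le x y).trans (add_le_add (hC s hs) (hD s hs))⟩

/-- The C*-algebraic tensor product `A ⊗ B`: the completion of the algebraic tensor product for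
the largest C*-norm. (For the algebra of two projections, which is nuclear, this is the only
C*-norm on the algebraic tensor product.) -/
abbrev CStarTensor (A B : Type*) [CStarAlgebra A] [CStarAlgebra B] : Type _ :=
  (tensorFamily A B).Envelope

/-- The elementary tensor `a ⊗ b`. -/
def ctmul {A B : Type*} [CStarAlgebra A] [CStarAlgebra B] (a : A) (b : B) : CStarTensor A B :=
  (tensorFamily A B).toEnvelope (a ⊗ₜ[ℂ] b)

/-- The product of `n × n` matrices with entries `∑ₖ (M₁)_ik ⊗ (M₂)_kj`. -/
def operp {n : ℕ} {A B : Type*} [CStarAlgebra A] [CStarAlgebra B]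
    (M₁ : Matrix (Fin n) (Fin n) A) (M₂ : Matrix (Fin n) (Fin n) B) :
    Matrix (Fin n) (Fin n) (CStarTensor A B) :=
  Matrix.of fun i j => ∑ k, ctmul (M₁ i k) (M₂ k j)

/-! ### The concrete magic unitary -/

/-- The initial magic unitary `R` over `A`. -/
def R : Matrix (Fin 4) (Fin 4) TwoProj :=
  !![p,     0,     1 - p, 0;
     1 - p, 0,     p,     0;
     0,     q,     0,     1 - q;
     0,     1 - q, 0,     q]

/-- The concrete magic unitary: the threefold product of `R` with itself, over `A ⊗ A ⊗ A`. -/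
def M : Matrix (Fin 4) (Fin 4) (CStarTensor (CStarTensor TwoProj TwoProj) TwoProj) :=
  operp (operp R R) R

/-! ### Noncommutative polynomials -/

/-- The degree of a noncommutative polynomial: the largest length of a word with nonzero
coefficient (and `0` for the zero polynomial). -/
def degree {X : Type*} (P : FreeAlgebra ℂ X) : ℕ :=
  (FreeAlgebra.equivMonoidAlgebraFreeMonoid P).coeff.support.sup FreeMonoid.length

/-- The value `P(N)` of a noncommutative polynomial `P` in the entries of an `n × n` matrix, at
a matrix `N` over a complex algebra: the image of `P` under the unital algebra homomorphism
`x_ij ↦ N_ij`. -/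
def eval {n : ℕ} {B : Type*} [Ring B] [Algebra ℂ B] (N : Matrix (Fin n) (Fin n) B)
    (P : FreeAlgebra ℂ (Fin n × Fin n)) : B :=
  FreeAlgebra.lift ℂ (fun ij : Fin n × Fin n => N ij.1 ij.2) P

end QPerm

end

open scoped TensorProduct

noncomputable section

namespace QPerm

/-! ### Universal properties -/

/-! One implication is the universal property: `R` is a magic unitary, products of magic unitaries
over tensor factors are magic, and so every relation that holds for `u` holds for `M`. The converse
rests on the description of C(S_4^+) as a twist of C(SO(3)).

Conjugation by the character table of the Klein four-group V turns a magic unitary into coefficients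
a_ij for which e_j ↦ ∑ᵢ e_i ⊗ a_ij is multiplicative on ℂ[V] (`IsMagic.isTwisted`). For nonzero
indices, two coefficients in a common row or column anticommute and all others commute. The matrices
of x ↦ e_i x (star e_j) on the quaternions obey the same signs, so tensoring a_ij with them removes
the twist: the new entries commute (`IsTwisted.commute_untwist`), are self-adjoint, and define an
endomorphism of the quaternions (`IsTwisted.isQuatEnd_untwist`). By Gelfand duality, a polynomial
identity in the model built from them has to be checked only at scalar points, that is, at rotations
x in SO(3), where the model is the 4-dimensional `quatModel x`. Nothing is lost on the way: building
`quatModel` twists back with a second copy of the same orthogonal matrices, and G ⊗ G fixes ∑ₛ e_s ⊗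
e_s for every real orthogonal G, so the value P(u) is read off at this vector
(`eval_fourier_eq_zero`).

It remains to obtain each `quatModel x` from `M`. By Euler angles, x is a product of three basic
rotations, one for each factor of `M` (`exists_eq_rotation_mul`). A pair of projections built from
Pauli matrices and one angle makes the Fourier transform of `R` a basic rotation whose entries are
decorated by Pauli matrices. Three copies on three tensor factors represent A ⊗ A ⊗ A on ℂ^8, and
the image of `M` leaves a 4-dimensional subspace invariant on which it is `quatModel x`
(`pauliModel_mul_quatIntertwiner`). -/

/-- The C*-seminorm `x ↦ ‖ρ x‖` attached to a *-homomorphism into a C*-algebra. -/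
def CStarSeminorm.ofHom {F C : Type*} [Ring F] [StarRing F] [Algebra ℂ F] [CStarAlgebra C]
    (ρ : F →⋆ₐ[ℂ] C) : CStarSeminorm F where
  toSeminorm := (normSeminorm ℂ C).comp ρ.toAlgHom.toLinearMap
  mul_le' x y := by
    change ‖ρ (x * y)‖ ≤ ‖ρ x‖ * ‖ρ y‖
    rw [map_mul]
    exact norm_mul_le _ _
  star_mul_self' x := by
    change ‖ρ (star x * x)‖ = ‖ρ x‖ ^ 2
    rw [map_mul, map_star, CStarRing.norm_star_mul_self, sq]

theorem CStarSeminorm.ofHom_apply {F C : Type*} [Ring F] [StarRing F] [Algebra ℂ F]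
    [CStarAlgebra C] (ρ : F →⋆ₐ[ℂ] C) (x : F) : CStarSeminorm.ofHom ρ x = ‖ρ x‖ := rfl

namespace BoundedFamily

variable {F C : Type*} [Ring F] [StarRing F] [Algebra ℂ F] [CStarAlgebra C] (S : BoundedFamily F)

/-- The seminorm of `ρ` is one of those under the supremum, so `ρ` is 1-Lipschitz on `S.Pre`. -/
theorem continuous_of_mem (ρ : F →⋆ₐ[ℂ] C) (h : CStarSeminorm.ofHom ρ ∈ S.carrier) :
    Continuous fun x : S.Pre => ρ x := by
  have hl : LipschitzWith 1 fun x : S.Pre => ρ x := LipschitzWith.of_dist_le_mul fun x y => by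
    rw [dist_eq_norm, dist_eq_norm, NNReal.coe_one, one_mul]
    exact (congrArg norm (map_sub ρ x y)).symm.le.trans (S.le_sup h (x - y : F))
  exact hl.continuous

/-- The extension of a *-homomorphism to the envelope, as a ring homomorphism. -/
def liftRingHom (ρ : F →⋆ₐ[ℂ] C) (h : CStarSeminorm.ofHom ρ ∈ S.carrier) : S.Envelope →+* C :=
  UniformSpace.Completion.extensionHom (α := S.Pre) (ρ.toAlgHom.toRingHom : S.Pre →+* C)
    (S.continuous_of_mem ρ h)

theorem continuous_liftRingHom (ρ : F →⋆ₐ[ℂ] C) (h : CStarSeminorm.ofHom ρ ∈ S.carrier) :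
    Continuous (S.liftRingHom ρ h) :=
  UniformSpace.Completion.continuous_extension

theorem liftRingHom_toEnvelope (ρ : F →⋆ₐ[ℂ] C) (h : CStarSeminorm.ofHom ρ ∈ S.carrier) (x : F) :
    S.liftRingHom ρ h (S.toEnvelope x) = ρ x :=
  UniformSpace.Completion.extensionHom_coe (α := S.Pre) _ (S.continuous_of_mem ρ h) x

/-- The extension of a *-homomorphism to the envelope. -/
def lift (ρ : F →⋆ₐ[ℂ] C) (h : CStarSeminorm.ofHom ρ ∈ S.carrier) : S.Envelope →⋆ₐ[ℂ] C where
  toRingHom := S.liftRingHom ρ h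
  commutes' c := by
    have hc : algebraMap ℂ S.Envelope c = S.toEnvelope (algebraMap ℂ F c) := rfl
    change S.liftRingHom ρ h _ = _
    rw [hc, liftRingHom_toEnvelope, AlgHomClass.commutes]
  map_star' x := by
    have hρ := S.continuous_liftRingHom ρ h
    refine S.envelope_induction
      (q := fun x => S.liftRingHom ρ h (star x) = star (S.liftRingHom ρ h x)) x
      (isClosed_eq (hρ.comp S.continuous_star_envelope) (continuous_star.comp hρ)) fun y => ?_
    rw [star_toEnvelope, liftRingHom_toEnvelope, liftRingHom_toEnvelope, map_star]

theorem lift_toEnvelope (ρ : F →⋆ₐ[ℂ] C) (h : CStarSeminorm.ofHom ρ ∈ S.carrier) (x : F) :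
    S.lift ρ h (S.toEnvelope x) = ρ x :=
  S.liftRingHom_toEnvelope ρ h x

/-- The canonical map into the envelope, as an algebra homomorphism. -/
def toEnvelopeHom : F →ₐ[ℂ] S.Envelope where
  toFun := S.toEnvelope
  map_one' := rfl
  map_mul' := S.toEnvelope_mul
  map_zero' := rfl
  map_add' := S.toEnvelope_add
  commutes' _ := rfl

theorem toEnvelopeHom_apply (x : F) : S.toEnvelopeHom x = S.toEnvelope x := rfl

theorem continuous_starAlgHom [StarModule ℂ F] (φ : S.Envelope →⋆ₐ[ℂ] C) : Continuous φ :=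
  AddMonoidHomClass.continuous_of_bound φ 1 fun x => by
    rw [one_mul]
    exact NonUnitalStarAlgHom.norm_apply_le φ x

end BoundedFamily

/-! ### Homomorphisms out of free *-algebras and presented C*-algebras -/

namespace FreeStarAlgebra

variable {E C : Type*} [CStarAlgebra C]

/-- The *-homomorphism from the free *-algebra that is determined by the images of the
generators. -/
def liftStar (c : E → C) : FreeStarAlgebra E →⋆ₐ[ℂ] C where
  toAlgHom := (FreeAlgebra.lift ℂ (Sum.elim c fun e => star (c e)) : FreeAlgebra ℂ (E ⊕ E) →ₐ[ℂ] C)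
  map_star' x := by
    set f : FreeStarAlgebra E →ₐ[ℂ] C :=
      (FreeAlgebra.lift ℂ (Sum.elim c fun e => star (c e)) : FreeAlgebra ℂ (E ⊕ E) →ₐ[ℂ] C) with hf
    change f (star x) = star (f x)
    have hl : ∀ e, f (letter e) = Sum.elim c (fun e => star (c e)) e := fun e =>
      FreeAlgebra.lift_ι_apply _ e
    refine induction (q := fun x => f (star x) = star (f x)) (fun z => ?_) (fun e => ?_)
      (fun x y hx hy => ?_) (fun x y hx hy => ?_) x
    · rw [star_algebraMap, AlgHom.commutes, AlgHom.commutes]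
      exact algebraMap_star_comm z
    · rw [star_letter, hl, hl]
      rcases e with e | e <;> simp
    · rw [star_mul', map_mul, map_mul, hx, hy, star_mul]
    · rw [star_add', map_add, map_add, hx, hy, star_add]

theorem liftStar_gen (c : E → C) (e : E) : liftStar c (gen e) = c e :=
  FreeAlgebra.lift_ι_apply (Sum.elim c fun e => star (c e)) (Sum.inl e)

end FreeStarAlgebra

namespace Presentation

variable {E C : Type*} [CStarAlgebra C] (Q : Presentation E)

theorem ofHom_liftStar_mem {c : E → C}
    (h : ∀ r ∈ Q.rel, FreeStarAlgebra.liftStar c r = 0) :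
    CStarSeminorm.ofHom (FreeStarAlgebra.liftStar c) ∈ Q.family.carrier := fun r hr => by
  rw [CStarSeminorm.ofHom_apply, h r hr, norm_zero]

/-- The universal property of `C*(E | Q)`. -/
def lift (c : E → C) (h : ∀ r ∈ Q.rel, FreeStarAlgebra.liftStar c r = 0) : Q.Universal →⋆ₐ[ℂ] C :=
  Q.family.lift (FreeStarAlgebra.liftStar c) (Q.ofHom_liftStar_mem h)

theorem lift_gen (c : E → C) (h : ∀ r ∈ Q.rel, FreeStarAlgebra.liftStar c r = 0) (e : E) :
    Q.lift c h (Q.gen e) = c e := by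
  rw [lift, gen, BoundedFamily.lift_toEnvelope, FreeStarAlgebra.liftStar_gen]

/-- The image of a relation in the universal C*-algebra vanishes. -/
theorem toEnvelope_eq_zero {r : FreeStarAlgebra E} (hr : r ∈ Q.rel) :
    Q.family.toEnvelope r = 0 := by
  rw [← norm_le_zero_iff, BoundedFamily.norm_toEnvelope]
  exact Q.family.sup_le le_rfl fun s hs => (hs r hr).le

/-- An element that commutes with the images of the generators and of their adjoints commutes with
the image of the whole universal C*-algebra. -/
theorem commute_of_commute_gen (φ : Q.Universal →⋆ₐ[ℂ] C) (y : C)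
    (h : ∀ e, Commute (φ (Q.gen e)) y) (h' : ∀ e, Commute (φ (star (Q.gen e))) y)
    (x : Q.Universal) : Commute (φ x) y := by
  have hφ : Continuous φ := Q.family.continuous_starAlgHom φ
  refine Q.family.envelope_induction (q := fun x => Commute (φ x) y) x
    (isClosed_eq (hφ.mul continuous_const) (continuous_const.mul hφ)) fun z => ?_
  refine FreeStarAlgebra.induction (q := fun z => Commute (φ (Q.family.toEnvelope z)) y)
    (fun c => ?_) (fun e => ?_) (fun a b ha hb => ?_) (fun a b ha hb => ?_) z
  · have hc : Q.family.toEnvelope (algebraMap ℂ _ c) = algebraMap ℂ Q.Universal c := rfl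
    rw [hc, AlgHomClass.commutes]
    exact Algebra.commutes c y
  · rcases e with e | e
    · exact h e
    · have he : FreeStarAlgebra.letter (Sum.inr e) = star (FreeStarAlgebra.gen e) :=
        (FreeStarAlgebra.star_letter (Sum.inl e)).symm
      rw [he, ← BoundedFamily.star_toEnvelope]
      exact h' e
  · rw [BoundedFamily.toEnvelope_mul, map_mul]
    exact ha.mul_left hb
  · rw [BoundedFamily.toEnvelope_add, map_add]
    exact ha.add_left hb

end Presentation

/-! ### Homomorphisms out of maximal tensor products -/

section Tensor

variable {A B C : Type*} [CStarAlgebra A] [CStarAlgebra B] [CStarAlgebra C]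

/-- The *-homomorphism on the algebraic tensor product that is induced by two commuting
*-homomorphisms. -/
def tensorStarHom (φ : A →⋆ₐ[ℂ] C) (ψ : B →⋆ₐ[ℂ] C) (h : ∀ a b, Commute (φ a) (ψ b)) :
    A ⊗[ℂ] B →⋆ₐ[ℂ] C where
  toAlgHom := Algebra.TensorProduct.lift φ.toAlgHom ψ.toAlgHom h
  map_star' x := by
    change Algebra.TensorProduct.lift φ.toAlgHom ψ.toAlgHom h (star x)
      = star (Algebra.TensorProduct.lift φ.toAlgHom ψ.toAlgHom h x)
    induction x using TensorProduct.induction_on with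
    | zero => simp
    | tmul a b =>
      rw [TensorProduct.star_tmul, Algebra.TensorProduct.lift_tmul,
        Algebra.TensorProduct.lift_tmul, star_mul]
      change φ (star a) * ψ (star b) = star (ψ b) * star (φ a)
      rw [map_star, map_star]
      exact (h a b).star_star
    | add x y hx hy => rw [star_add, map_add, map_add, star_add, hx, hy]

/-- The universal property of the maximal tensor product. -/
def ctensorLift (φ : A →⋆ₐ[ℂ] C) (ψ : B →⋆ₐ[ℂ] C) (h : ∀ a b, Commute (φ a) (ψ b)) :
    CStarTensor A B →⋆ₐ[ℂ] C :=
  (tensorFamily A B).lift (tensorStarHom φ ψ h) (Set.mem_univ _)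

theorem ctensorLift_ctmul (φ : A →⋆ₐ[ℂ] C) (ψ : B →⋆ₐ[ℂ] C) (h : ∀ a b, Commute (φ a) (ψ b))
    (a : A) (b : B) : ctensorLift φ ψ h (ctmul a b) = φ a * ψ b := by
  refine ((tensorFamily A B).lift_toEnvelope (tensorStarHom φ ψ h) (Set.mem_univ _) _).trans ?_
  exact Algebra.TensorProduct.lift_tmul _ _ h a b

/-- Needed to iterate `ctensorLift` over (A ⊗ A) ⊗ A: commutation passes from elementary tensors to
sums, and to limits because the commutant condition is closed. -/
theorem commute_ctensorLift (φ : A →⋆ₐ[ℂ] C) (ψ : B →⋆ₐ[ℂ] C) (h : ∀ a b, Commute (φ a) (ψ b))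
    (y : C) (hφ : ∀ a, Commute (φ a) y) (hψ : ∀ b, Commute (ψ b) y) (x : CStarTensor A B) :
    Commute (ctensorLift φ ψ h x) y := by
  have hc := (tensorFamily A B).continuous_starAlgHom (ctensorLift φ ψ h)
  refine (tensorFamily A B).envelope_induction
    (q := fun x => Commute (ctensorLift φ ψ h x) y) x
    (isClosed_eq (hc.mul continuous_const) (continuous_const.mul hc)) fun z => ?_
  induction z using TensorProduct.induction_on with
  | zero =>
    have h0 : (tensorFamily A B).toEnvelope 0 = 0 := rfl
    rw [h0, map_zero]
    exact Commute.zero_left y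
  | tmul a b =>
    rw [← ctmul, ctensorLift_ctmul]
    exact (hφ a).mul_left (hψ b)
  | add z w hz hw =>
    rw [BoundedFamily.toEnvelope_add, map_add]
    exact hz.add_left hw

end Tensor

/-! ### Magic unitaries -/

theorem eval_map {n : ℕ} {B B' : Type*} [Ring B] [Algebra ℂ B] [Ring B'] [Algebra ℂ B']
    (φ : B →ₐ[ℂ] B') (N : Matrix (Fin n) (Fin n) B) (P : FreeAlgebra ℂ (Fin n × Fin n)) :
    eval (N.map φ) P = φ (eval N P) := by
  have h : FreeAlgebra.lift ℂ (fun ij : Fin n × Fin n => (N.map φ) ij.1 ij.2)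
      = φ.comp (FreeAlgebra.lift ℂ fun ij : Fin n × Fin n => N ij.1 ij.2) := by
    ext ij
    simp
  exact DFunLike.congr_fun h P

/-- If the projections of a finite family sum up to `1`, then they are pairwise orthogonal. -/
theorem mul_eq_zero_of_sum_eq_one {C ι : Type*} [CStarAlgebra C] [Fintype ι] {e : ι → C}
    (hi : ∀ i, e i * e i = e i) (hs : ∀ i, star (e i) = e i) (h1 : ∑ i, e i = 1) {i j : ι}
    (hij : i ≠ j) : e i * e j = 0 := by
  classical
  let _ : PartialOrder C := CStarAlgebra.spectralOrder C
  have _ : StarOrderedRing C := CStarAlgebra.spectralOrderedRing C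
  -- Compressing 1 = ∑ e_k by e_j leaves ∑_{k ≠ j} e_j e_k e_j = 0. The terms are (e_k e_j)* (e_k
  -- e_j) ≥ 0, so each one vanishes.
  have h2 : ∑ k, e j * e k * e j = e j := by
    rw [← Finset.sum_mul, ← Finset.mul_sum, h1, mul_one, hi]
  rw [← Finset.add_sum_erase _ _ (Finset.mem_univ j), hi, hi, add_eq_left] at h2
  have h3 : ∀ k, e j * e k * e j = star (e k * e j) * (e k * e j) := fun k => by
    rw [star_mul, hs, hs, mul_assoc, mul_assoc, ← mul_assoc (e k) (e k), hi]
  rw [Finset.sum_eq_zero_iff_of_nonneg fun k _ => by rw [h3]; exact star_mul_self_nonneg _] at h2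
  have h4 := h2 i (Finset.mem_erase.2 ⟨hij, Finset.mem_univ i⟩)
  rwa [h3, CStarRing.star_mul_self_eq_zero_iff] at h4

/-- A magic unitary: a square matrix of projections that sum up to `1` in each row and column. -/
structure IsMagic {n : ℕ} {C : Type*} [Ring C] [StarRing C] (m : Matrix (Fin n) (Fin n) C) :
    Prop where
  idem : ∀ i j, m i j * m i j = m i j
  star_eq : ∀ i j, star (m i j) = m i j
  row_sum : ∀ i, ∑ k, m i k = 1
  col_sum : ∀ j, ∑ k, m k j = 1

namespace IsMagic

variable {n : ℕ} {C : Type*} [CStarAlgebra C]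

theorem row_mul {m : Matrix (Fin n) (Fin n) C} (h : IsMagic m) (i j k : Fin n) :
    m i j * m i k = if j = k then m i j else 0 := by
  split_ifs with hjk
  · rw [hjk, h.idem]
  · exact mul_eq_zero_of_sum_eq_one (e := fun l => m i l) (h.idem i) (h.star_eq i) (h.row_sum i) hjk

end IsMagic

/-! ### Tensor products of magic unitaries -/

section

variable {A B : Type*} [CStarAlgebra A] [CStarAlgebra B]

theorem ctmul_mul (a a' : A) (b b' : B) :
    ctmul a b * ctmul a' b' = ctmul (a * a') (b * b') := by
  rw [ctmul, ctmul, ctmul, ← BoundedFamily.toEnvelope_mul, Algebra.TensorProduct.tmul_mul_tmul]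

theorem star_ctmul (a : A) (b : B) : star (ctmul a b) = ctmul (star a) (star b) := by
  rw [ctmul, ctmul, BoundedFamily.star_toEnvelope, TensorProduct.star_tmul]

theorem ctmul_one_one : ctmul (1 : A) (1 : B) = 1 := rfl

theorem zero_ctmul (b : B) : ctmul (0 : A) b = 0 := by
  rw [ctmul, TensorProduct.zero_tmul]
  rfl

theorem sum_ctmul {ι : Type*} (s : Finset ι) (f : ι → A) (b : B) :
    ctmul (∑ i ∈ s, f i) b = ∑ i ∈ s, ctmul (f i) b := by
  rw [ctmul, TensorProduct.sum_tmul, ← BoundedFamily.toEnvelopeHom_apply, map_sum]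
  rfl

theorem ctmul_sum {ι : Type*} (s : Finset ι) (a : A) (f : ι → B) :
    ctmul a (∑ i ∈ s, f i) = ∑ i ∈ s, ctmul a (f i) := by
  rw [ctmul, TensorProduct.tmul_sum, ← BoundedFamily.toEnvelopeHom_apply, map_sum]
  rfl

/-- Idempotency is the only nontrivial point: orthogonality within a row of `m₁` kills the mixed
terms k ≠ l of the square. -/
theorem IsMagic.operp {n : ℕ} {m₁ : Matrix (Fin n) (Fin n) A} {m₂ : Matrix (Fin n) (Fin n) B}
    (h₁ : IsMagic m₁) (h₂ : IsMagic m₂) : IsMagic (operp m₁ m₂) where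
  idem i j := by
    simp only [QPerm.operp, Matrix.of_apply, Finset.sum_mul_sum, ctmul_mul, h₁.row_mul]
    refine Finset.sum_congr rfl fun k _ => ?_
    rw [Finset.sum_eq_single k (fun l _ hl => by rw [if_neg hl.symm, zero_ctmul])
      (fun hk => absurd (Finset.mem_univ k) hk), if_pos rfl, h₂.idem]
  star_eq i j := by
    simp only [QPerm.operp, Matrix.of_apply, star_sum, star_ctmul, h₁.star_eq, h₂.star_eq]
  row_sum i := by
    simp only [QPerm.operp, Matrix.of_apply]
    rw [Finset.sum_comm]
    simp only [← ctmul_sum, h₂.row_sum]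
    rw [← sum_ctmul, h₁.row_sum, ctmul_one_one]
  col_sum j := by
    simp only [QPerm.operp, Matrix.of_apply]
    rw [Finset.sum_comm]
    simp only [← sum_ctmul, h₁.col_sum]
    rw [← ctmul_sum, h₂.col_sum, ctmul_one_one]

end

theorem isMagic_u (n : ℕ) : IsMagic (u n) where
  idem i j := by
    have h := (magicPresentation n).toEnvelope_eq_zero (Or.inl ⟨i, j, rfl⟩)
    rw [← BoundedFamily.toEnvelopeHom_apply, map_sub, map_mul, sub_eq_zero] at h
    exact h
  star_eq i j := by
    have h := (magicPresentation n).toEnvelope_eq_zero (Or.inr (Or.inl ⟨i, j, rfl⟩))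
    rw [← BoundedFamily.toEnvelopeHom_apply, map_sub, BoundedFamily.toEnvelopeHom_apply,
      ← BoundedFamily.star_toEnvelope, sub_eq_zero] at h
    exact h
  row_sum i := by
    have h := (magicPresentation n).toEnvelope_eq_zero (Or.inr (Or.inr (Or.inl ⟨i, rfl⟩)))
    rw [← BoundedFamily.toEnvelopeHom_apply, map_sub, map_sum, map_one, sub_eq_zero] at h
    exact h
  col_sum j := by
    have h := (magicPresentation n).toEnvelope_eq_zero (Or.inr (Or.inr (Or.inr ⟨j, rfl⟩)))
    rw [← BoundedFamily.toEnvelopeHom_apply, map_sub, map_sum, map_one, sub_eq_zero] at h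
    exact h

/-- A noncommutative polynomial that vanishes at the universal magic unitary vanishes at every
magic unitary in a C*-algebra. -/
theorem eval_eq_zero_of_isMagic {n : ℕ} {C : Type*} [CStarAlgebra C]
    {m : Matrix (Fin n) (Fin n) C} (hm : IsMagic m) {P : FreeAlgebra ℂ (Fin n × Fin n)}
    (hP : eval (u n) P = 0) : eval m P = 0 := by
  have hrel : ∀ r ∈ (magicPresentation n).rel,
      FreeStarAlgebra.liftStar (fun ij : Fin n × Fin n => m ij.1 ij.2) r = 0 := by
    rintro _ (⟨i, j, rfl⟩ | ⟨i, j, rfl⟩ | ⟨i, rfl⟩ | ⟨j, rfl⟩)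
    · rw [map_sub, map_mul, FreeStarAlgebra.liftStar_gen, hm.idem, sub_self]
    · rw [map_sub, map_star, FreeStarAlgebra.liftStar_gen, hm.star_eq, sub_self]
    · simp only [map_sub, map_sum, map_one, FreeStarAlgebra.liftStar_gen, hm.row_sum, sub_self]
    · simp only [map_sub, map_sum, map_one, FreeStarAlgebra.liftStar_gen, hm.col_sum, sub_self]
  have hmap : m = (u n).map ((magicPresentation n).lift _ hrel).toAlgHom :=
    Matrix.ext fun i j => ((magicPresentation n).lift_gen _ hrel (i, j)).symm
  rw [hmap, eval_map, hP, map_zero]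

theorem p_mul_p : p * p = p := by
  have h := twoProjPresentation.toEnvelope_eq_zero (Or.inl ⟨0, rfl⟩)
  rw [← BoundedFamily.toEnvelopeHom_apply, map_sub, map_mul, sub_eq_zero] at h
  exact h

theorem q_mul_q : q * q = q := by
  have h := twoProjPresentation.toEnvelope_eq_zero (Or.inl ⟨1, rfl⟩)
  rw [← BoundedFamily.toEnvelopeHom_apply, map_sub, map_mul, sub_eq_zero] at h
  exact h

theorem star_p : star p = p := by
  have h := twoProjPresentation.toEnvelope_eq_zero (Or.inr ⟨0, rfl⟩)
  rw [← BoundedFamily.toEnvelopeHom_apply, map_sub, BoundedFamily.toEnvelopeHom_apply,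
    ← BoundedFamily.star_toEnvelope, sub_eq_zero] at h
  exact h

theorem star_q : star q = q := by
  have h := twoProjPresentation.toEnvelope_eq_zero (Or.inr ⟨1, rfl⟩)
  rw [← BoundedFamily.toEnvelopeHom_apply, map_sub, BoundedFamily.toEnvelopeHom_apply,
    ← BoundedFamily.star_toEnvelope, sub_eq_zero] at h
  exact h

theorem isMagic_R : IsMagic R where
  idem i j := by
    fin_cases i <;> fin_cases j <;>
      simp [R, mul_sub, sub_mul, p_mul_p, q_mul_q]
  star_eq i j := by
    fin_cases i <;> fin_cases j <;> simp [R, star_p, star_q]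
  row_sum i := by
    fin_cases i <;> simp [R, Fin.sum_univ_four]
  col_sum j := by
    fin_cases j <;> simp [R, Fin.sum_univ_four]

theorem isMagic_M : IsMagic M := (isMagic_R.operp isMagic_R).operp isMagic_R

/-! ### Representations of the threefold tensor product -/

section

variable {C : Type*} [CStarAlgebra C]

/-- The *-homomorphism on `A` that is determined by two projections. -/
def twoProjLift (a b : C) (ha : a * a = a) (hb : b * b = b) (ha' : star a = a) (hb' : star b = b) :
    TwoProj →⋆ₐ[ℂ] C :=
  twoProjPresentation.lift ![a, b] <| by
    rintro _ (⟨i, rfl⟩ | ⟨i, rfl⟩)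
    · rw [map_sub, map_mul, FreeStarAlgebra.liftStar_gen]
      fin_cases i <;> simp [ha, hb]
    · rw [map_sub, map_star, FreeStarAlgebra.liftStar_gen]
      fin_cases i <;> simp [ha', hb']

theorem twoProjLift_p (a b : C) (ha : a * a = a) (hb : b * b = b) (ha' : star a = a)
    (hb' : star b = b) : twoProjLift a b ha hb ha' hb' p = a :=
  twoProjPresentation.lift_gen _ _ 0

theorem twoProjLift_q (a b : C) (ha : a * a = a) (hb : b * b = b) (ha' : star a = a)
    (hb' : star b = b) : twoProjLift a b ha hb ha' hb' q = b :=
  twoProjPresentation.lift_gen _ _ 1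

/-- The generators are self-adjoint, so their adjoints impose no further condition. -/
theorem commute_of_commute_p_q (φ : TwoProj →⋆ₐ[ℂ] C) {y : C} (hp : Commute (φ p) y)
    (hq : Commute (φ q) y) (x : TwoProj) : Commute (φ x) y := by
  refine twoProjPresentation.commute_of_commute_gen φ y (fun e => ?_) (fun e => ?_) x
  · fin_cases e
    exacts [hp, hq]
  · fin_cases e
    · change Commute (φ (star p)) y
      rwa [star_p]
    · change Commute (φ (star q)) y
      rwa [star_q]

theorem commute_of_commute_generators (φ ψ : TwoProj →⋆ₐ[ℂ] C) (hpp : Commute (φ p) (ψ p))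
    (hpq : Commute (φ p) (ψ q)) (hqp : Commute (φ q) (ψ p)) (hqq : Commute (φ q) (ψ q))
    (x y : TwoProj) : Commute (φ x) (ψ y) :=
  commute_of_commute_p_q φ (commute_of_commute_p_q ψ hpp.symm hpq.symm y).symm
    (commute_of_commute_p_q ψ hqp.symm hqq.symm y).symm x

/-- If a polynomial vanishes at `M`, it vanishes at the product of the images of `R` under three
representations of `A` with commuting ranges. -/
theorem eval_map_mul_map_mul_map (φ₁ φ₂ φ₃ : TwoProj →⋆ₐ[ℂ] C)
    (h₁₂ : ∀ x y, Commute (φ₁ x) (φ₂ y)) (h₁₃ : ∀ x y, Commute (φ₁ x) (φ₃ y))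
    (h₂₃ : ∀ x y, Commute (φ₂ x) (φ₃ y)) {P : FreeAlgebra ℂ (Fin 4 × Fin 4)}
    (hP : eval M P = 0) : eval (R.map φ₁ * R.map φ₂ * R.map φ₃) P = 0 := by
  let Φ := ctensorLift (ctensorLift φ₁ φ₂ h₁₂) φ₃ fun x y =>
    commute_ctensorLift φ₁ φ₂ h₁₂ (φ₃ y) (fun a => h₁₃ a y) (fun b => h₂₃ b y) x
  have h : R.map φ₁ * R.map φ₂ * R.map φ₃ = M.map Φ.toAlgHom := by
    ext i j
    change _ = Φ (M i j)
    simp only [M, operp, Matrix.mul_apply, Matrix.map_apply, Matrix.of_apply, map_sum, Φ,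
      ctensorLift_ctmul]
  rw [h, eval_map, hP, map_zero]

end

/-! ### The Fourier transform of the Klein four-group -/

/-- The addition of the Klein four-group on `Fin 4`. -/
def klein (i j : Fin 4) : Fin 4 :=
  !![0, 1, 2, 3; 1, 0, 3, 2; 2, 3, 0, 1; 3, 2, 1, 0] i j

/-- The character table of the Klein four-group. -/
def hadamard : Matrix (Fin 4) (Fin 4) ℂ :=
  !![1, 1, 1, 1; 1, 1, -1, -1; 1, -1, 1, -1; 1, -1, -1, 1]

theorem hadamard_symm (i j : Fin 4) : hadamard i j = hadamard j i := by
  fin_cases i <;> fin_cases j <;> rfl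

/-- The columns are characters of the Klein group. This is what makes products of half-transformed
entries add their indices in `IsMagic.fourier_col`. -/
theorem hadamard_klein (i j k : Fin 4) :
    hadamard (klein i j) k = hadamard i k * hadamard j k := by
  fin_cases i <;> fin_cases j <;> fin_cases k <;> simp [hadamard, klein]

theorem hadamard_mul_hadamard : hadamard * hadamard = (4 : ℂ) • 1 := by
  ext i j
  fin_cases i <;> fin_cases j <;> simp [hadamard, Matrix.mul_apply, Fin.sum_univ_four] <;> norm_num

theorem sum_hadamard_mul (i j : Fin 4) :
    ∑ k, hadamard k i * hadamard k j = if i = j then 4 else 0 := by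
  have h := congrFun (congrFun hadamard_mul_hadamard i) j
  simp only [Matrix.mul_apply, Matrix.smul_apply, Matrix.one_apply, smul_eq_mul, mul_ite, mul_one,
    mul_zero] at h
  rw [← h]
  exact Finset.sum_congr rfl fun k _ => by rw [hadamard_symm k i]

theorem hadamard_zero (i : Fin 4) : hadamard 0 i = 1 := by
  fin_cases i <;> rfl

section Fourier

variable {B B' : Type*} [Ring B] [Algebra ℂ B] [Ring B'] [Algebra ℂ B']

/-- The Fourier transform in both indices of a `4 × 4` matrix. -/
def fourier (m : Matrix (Fin 4) (Fin 4) B) : Matrix (Fin 4) (Fin 4) B :=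
  Matrix.of fun i j => (4⁻¹ : ℂ) • ∑ k, ∑ l, (hadamard k i * hadamard l j) • m k l

theorem fourier_apply (m : Matrix (Fin 4) (Fin 4) B) (i j : Fin 4) :
    fourier m i j = (4⁻¹ : ℂ) • ∑ k, ∑ l, (hadamard k i * hadamard l j) • m k l := rfl

/-- With H the character table, H² = 4, so the transform is conjugation by the involution H/2. Hence
it is both multiplicative and an involution. -/
theorem fourier_eq_mul (m : Matrix (Fin 4) (Fin 4) B) :
    fourier m = (4⁻¹ : ℂ) •
      (hadamard.map (algebraMap ℂ B) * m * hadamard.map (algebraMap ℂ B)) := by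
  ext i j
  rw [fourier_apply, Matrix.smul_apply, Matrix.mul_apply, Finset.sum_comm]
  congr 1
  refine Finset.sum_congr rfl fun l _ => ?_
  rw [Matrix.mul_apply, Finset.sum_mul]
  refine Finset.sum_congr rfl fun k _ => ?_
  rw [Matrix.map_apply, Matrix.map_apply, ← Algebra.commutes, Algebra.smul_def, map_mul, mul_assoc,
    hadamard_symm k i, ← mul_assoc, ← mul_assoc, Algebra.commutes (hadamard i k)]

theorem hadamard_map_mul_hadamard_map :
    hadamard.map (algebraMap ℂ B) * hadamard.map (algebraMap ℂ B) = (4 : ℂ) • 1 := by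
  rw [← Matrix.map_mul, hadamard_mul_hadamard]
  ext i j
  by_cases h : i = j <;> simp [Matrix.smul_apply, h, Algebra.algebraMap_eq_smul_one]

theorem fourier_mul (m m' : Matrix (Fin 4) (Fin 4) B) :
    fourier (m * m') = fourier m * fourier m' := by
  simp only [fourier_eq_mul]
  set H := hadamard.map (algebraMap ℂ B)
  have h : H * m * H * (H * m' * H) = (4 : ℂ) • (H * (m * m') * H) := by
    calc H * m * H * (H * m' * H) = H * m * (H * H) * m' * H := by noncomm_ring
      _ = (4 : ℂ) • (H * (m * m') * H) := by
        rw [hadamard_map_mul_hadamard_map, mul_smul_comm, mul_one, smul_mul_assoc, smul_mul_assoc,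
          mul_assoc H m m']
  rw [smul_mul_smul_comm, h, smul_smul]
  norm_num

theorem fourier_fourier (m : Matrix (Fin 4) (Fin 4) B) : fourier (fourier m) = m := by
  simp only [fourier_eq_mul]
  set H := hadamard.map (algebraMap ℂ B)
  have h : H * (H * m * H) * H = (16 : ℂ) • m := by
    calc H * (H * m * H) * H = H * H * m * (H * H) := by noncomm_ring
      _ = (16 : ℂ) • m := by
        rw [hadamard_map_mul_hadamard_map, smul_mul_assoc, one_mul, smul_mul_smul_comm, mul_one]
        norm_num
  rw [mul_smul_comm, smul_mul_assoc, h, smul_smul, smul_smul]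
  norm_num

theorem fourier_transpose (m : Matrix (Fin 4) (Fin 4) B) :
    fourier m.transpose = (fourier m).transpose := by
  ext i j
  rw [Matrix.transpose_apply, fourier_apply, fourier_apply, Finset.sum_comm]
  refine congrArg _ (Finset.sum_congr rfl fun k _ => Finset.sum_congr rfl fun l _ => ?_)
  rw [Matrix.transpose_apply, mul_comm]

theorem fourier_map (φ : B →ₗ[ℂ] B') (m : Matrix (Fin 4) (Fin 4) B) :
    fourier (m.map φ) = (fourier m).map φ := by
  ext i j
  simp only [fourier_apply, Matrix.map_apply, map_smul, map_sum]

end Fourier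

/-! ### The Fourier transform of a magic unitary -/

/-- The relations between the Fourier coefficients of a `4 × 4` magic unitary. -/
structure IsTwisted {B : Type*} [Ring B] (a : Matrix (Fin 4) (Fin 4) B) : Prop where
  zero_zero : a 0 0 = 1
  zero_left : ∀ j ≠ 0, a 0 j = 0
  zero_right : ∀ i ≠ 0, a i 0 = 0
  -- With e_l e_{l+i} = e_i in the group algebra of the Klein group, this says that e_j ↦ ∑ₗ e_l ⊗
  -- a_lj is multiplicative; `row` says the same for the transpose.
  col : ∀ i j k, ∑ l, a l j * a (klein l i) k = a i (klein j k)
  row : ∀ i j k, ∑ l, a j l * a k (klein l i) = a (klein j k) i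

theorem IsMagic.transpose {n : ℕ} {C : Type*} [Ring C] [StarRing C] {m : Matrix (Fin n) (Fin n) C}
    (h : IsMagic m) : IsMagic m.transpose where
  idem i j := h.idem j i
  star_eq i j := h.star_eq j i
  row_sum i := h.col_sum i
  col_sum j := h.row_sum j

theorem sum_hadamard (i : Fin 4) : ∑ k, hadamard k i = if i = 0 then 4 else 0 := by
  simpa [hadamard_symm _ 0, hadamard_zero, eq_comm] using sum_hadamard_mul i 0

section

variable {C : Type*} [CStarAlgebra C] {m : Matrix (Fin 4) (Fin 4) C}

theorem IsMagic.fourier_zero_left (h : IsMagic m) (j : Fin 4) :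
    fourier m 0 j = if j = 0 then 1 else 0 := by
  rw [fourier_apply, Finset.sum_comm]
  simp only [hadamard_symm _ 0, hadamard_zero, one_mul, ← Finset.smul_sum, h.col_sum]
  rw [← Finset.sum_smul, sum_hadamard]
  split_ifs <;> simp [smul_smul]

/-- Transforming only the column index makes each row a representation of the Klein group, because
its entries are orthogonal projections with sum 1. The transform in the row index then converts
pointwise products into convolutions. -/
theorem IsMagic.fourier_col (h : IsMagic m) (i j k : Fin 4) :
    ∑ l, fourier m l j * fourier m (klein l i) k = fourier m i (klein j k) := by
  set w : Fin 4 → Fin 4 → C := fun r j => ∑ s, hadamard s j • m r s with hw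
  have hf : ∀ i j, fourier m i j = (4⁻¹ : ℂ) • ∑ r, hadamard r i • w r j := fun i j => by
    simp only [fourier_apply, hw, Finset.smul_sum, smul_smul]
  have hww : ∀ r, w r j * w r k = w r (klein j k) := fun r => by
    simp only [hw, Finset.sum_mul_sum, smul_mul_smul_comm, h.row_mul, smul_ite, smul_zero,
      Finset.sum_ite_eq, Finset.mem_univ, if_true, hadamard_symm _ (klein j k), hadamard_klein]
    simp only [hadamard_symm j, hadamard_symm k]
  have h1 : ∀ l, fourier m l j * fourier m (klein l i) k
      = (16⁻¹ : ℂ) • ∑ r, ∑ s, (hadamard l r * hadamard l s) • (hadamard i s • (w r j * w s k)) :=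
    fun l => by
      rw [hf, hf, smul_mul_smul_comm, Finset.sum_mul_sum]
      norm_num
      refine Finset.sum_congr rfl fun r _ => Finset.sum_congr rfl fun s _ => ?_
      rw [hadamard_symm s, hadamard_klein, smul_smul, smul_smul, hadamard_symm r]
      congr 1
      ring
  simp only [h1]
  rw [← Finset.smul_sum, Finset.sum_comm]
  -- Orthogonality of characters, summed over l, leaves only s = r.
  have h2 : ∀ r, ∑ l, ∑ s, (hadamard l r * hadamard l s) • (hadamard i s • (w r j * w s k))
      = (4 : ℂ) • (hadamard r i • w r (klein j k)) := fun r => by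
    rw [Finset.sum_comm]
    simp only [← Finset.sum_smul, sum_hadamard_mul, ite_smul, zero_smul, Finset.sum_ite_eq,
      Finset.mem_univ, if_true, hww, hadamard_symm r]
  rw [Finset.sum_congr rfl fun r _ => h2 r, ← Finset.smul_sum, smul_smul, hf]
  norm_num

theorem IsMagic.isTwisted (h : IsMagic m) : IsTwisted (fourier m) where
  zero_zero := by rw [h.fourier_zero_left, if_pos rfl]
  zero_left j hj := by rw [h.fourier_zero_left, if_neg hj]
  zero_right i hi := by
    have h1 := h.transpose.fourier_zero_left i
    rwa [if_neg hi, fourier_transpose] at h1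
  col := h.fourier_col
  row i j k := by
    have h1 := h.transpose.fourier_col i j k
    rwa [fourier_transpose] at h1

theorem IsMagic.star_fourier (h : IsMagic m) (i j : Fin 4) :
    star (fourier m i j) = fourier m i j := by
  have hh : ∀ i j, star (hadamard i j) = hadamard i j := fun i j => by
    fin_cases i <;> fin_cases j <;> simp [hadamard]
  simp only [fourier_apply, star_smul, star_sum, h.star_eq, star_mul, hh]
  norm_num
  simp only [mul_comm]

end

/-! ### Commutation and anticommutation of the Fourier coefficients -/

namespace IsTwisted

variable {B : Type*} [Ring B] {a : Matrix (Fin 4) (Fin 4) B}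

/-- Here i + j is the third nonzero element, and its decompositions into two summands are 0 + (i +
j), i + j and their reversals. -/
theorem sum_klein {i j : Fin 4} (hi : i ≠ 0) (hj : j ≠ 0) (hij : i ≠ j) (f : Fin 4 → Fin 4 → B) :
    ∑ l, f l (klein l (klein i j)) =
      f 0 (klein i j) + f (klein i j) 0 + (f i j + f j i) := by
  fin_cases i <;> fin_cases j <;> simp [klein, Fin.sum_univ_four] at hi hj hij ⊢ <;> abel

theorem transpose (h : IsTwisted a) : IsTwisted a.transpose where
  zero_zero := h.zero_zero
  zero_left := h.zero_right
  zero_right := h.zero_left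
  col := h.row
  row := h.col

/-- Of the four terms of the convolution, the two containing a coefficient of row 0 vanish, since
the column indices are nonzero. -/
theorem col_pair (h : IsTwisted a) {i i' j j' : Fin 4} (hi : i ≠ 0) (hi' : i' ≠ 0) (hii : i ≠ i')
    (hj : j ≠ 0) (hj' : j' ≠ 0) :
    a i j * a i' j' + a i' j * a i j' = a (klein i i') (klein j j') := by
  rw [← h.col, sum_klein hi hi' hii fun l l' => a l j * a l' j', h.zero_left j hj,
    h.zero_left j' hj', zero_mul, mul_zero, zero_add, zero_add]

theorem row_pair (h : IsTwisted a) {i i' j j' : Fin 4} (hi : i ≠ 0) (hi' : i' ≠ 0)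
    (hj : j ≠ 0) (hj' : j' ≠ 0) (hjj : j ≠ j') :
    a i j * a i' j' + a i j' * a i' j = a (klein i i') (klein j j') :=
  h.transpose.col_pair hj hj' hjj hi hi'

theorem klein_self (i : Fin 4) : klein i i = 0 := by
  fin_cases i <;> rfl

theorem klein_ne_zero {i j : Fin 4} (h : i ≠ j) : klein i j ≠ 0 := by
  revert h
  fin_cases i <;> fin_cases j <;> simp [klein]

/-- The case i = i' of `row_pair`, whose right side lies in row 0 at a nonzero column. -/
theorem row_anticomm (h : IsTwisted a) {i j j' : Fin 4} (hi : i ≠ 0) (hj : j ≠ 0) (hj' : j' ≠ 0)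
    (hjj : j ≠ j') : a i j * a i j' = -(a i j' * a i j) := by
  have h1 := h.row_pair hi hi hj hj' hjj
  rw [klein_self, h.zero_left _ (klein_ne_zero hjj)] at h1
  exact eq_neg_of_add_eq_zero_left h1

theorem col_anticomm (h : IsTwisted a) {i i' j : Fin 4} (hi : i ≠ 0) (hi' : i' ≠ 0) (hj : j ≠ 0)
    (hii : i ≠ i') : a i j * a i' j = -(a i' j * a i j) :=
  h.transpose.row_anticomm hj hi hi' hii

/-- `col_pair` and `row_pair` expand the same coefficient and share the term a_{i'j} a_{ij'}. What
remains is the commutation. -/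
theorem comm (h : IsTwisted a) {i i' j j' : Fin 4} (hi : i ≠ 0) (hi' : i' ≠ 0) (hii : i ≠ i')
    (hj : j ≠ 0) (hj' : j' ≠ 0) (hjj : j ≠ j') : a i j * a i' j' = a i' j' * a i j := by
  have h1 := h.col_pair hi hi' hii hj hj'
  have h3 := h.row_pair hi' hi hj' hj hjj.symm
  have hk : ∀ i j, klein i j = klein j i := by
    intro i j
    fin_cases i <;> fin_cases j <;> rfl
  rw [hk i' i, hk j' j] at h3
  rw [← h3] at h1
  exact add_right_cancel h1

end IsTwisted

/-! ### Quaternions -/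

/-- The signs in `e_i e_j = ± e_{i + j}`, where `e_0, …, e_3` are the quaternion units. -/
def quatSign (i j : Fin 4) : ℤ :=
  !![1, 1, 1, 1; 1, -1, 1, -1; 1, -1, -1, 1; 1, 1, -1, -1] i j

/-- The matrix of the left multiplication `x ↦ e_i x` of quaternions. -/
def quatLeft (i : Fin 4) : Matrix (Fin 4) (Fin 4) ℤ :=
  Matrix.of fun r s => if r = klein i s then quatSign i s else 0

/-- The matrix of the right multiplication `x ↦ x (star e_j)` of quaternions. -/
def quatRight (j : Fin 4) : Matrix (Fin 4) (Fin 4) ℤ :=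
  Matrix.of fun r s => if r = klein s j then quatSign s j * quatSign j j else 0

/-- The matrix of `x ↦ e_i x (star e_j)`. -/
def quatConj (i j : Fin 4) : Matrix (Fin 4) (Fin 4) ℤ := quatLeft i * quatRight j

theorem quatLeft_mul (i j : Fin 4) :
    quatLeft i * quatLeft j = quatSign i j • quatLeft (klein i j) := by
  revert i j
  decide

/-- The conjugate makes right multiplication order-preserving: x (star e_j)(star e_i) = x star (e_i
e_j). -/
theorem quatRight_mul (i j : Fin 4) :
    quatRight i * quatRight j = quatSign i j • quatRight (klein i j) := by
  revert i j
  decide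

theorem quatRight_mul_quatLeft (i j : Fin 4) :
    quatRight j * quatLeft i = quatLeft i * quatRight j := by
  revert i j
  decide

theorem quatConj_mul (i j i' j' : Fin 4) : quatConj i j * quatConj i' j' =
    (quatSign i i' * quatSign j j') • quatConj (klein i i') (klein j j') := by
  calc quatConj i j * quatConj i' j'
      = quatLeft i * (quatRight j * quatLeft i') * quatRight j' := by
        simp only [quatConj, mul_assoc]
    _ = quatLeft i * quatLeft i' * (quatRight j * quatRight j') := by
        rw [quatRight_mul_quatLeft]
        simp only [mul_assoc]
    _ = _ := by rw [quatLeft_mul, quatRight_mul, smul_mul_smul_comm, quatConj]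

theorem quatLeft_mul_transpose (i : Fin 4) : quatLeft i * (quatLeft i).transpose = 1 := by
  revert i
  decide

theorem quatRight_mul_transpose (i : Fin 4) : quatRight i * (quatRight i).transpose = 1 := by
  revert i
  decide

/-- Orthogonality is what makes ∑ₛ e_s ⊗ e_s invariant in `sum_quatModel_untwist`. -/
theorem quatConj_mul_transpose (i j : Fin 4) : quatConj i j * (quatConj i j).transpose = 1 := by
  rw [quatConj, Matrix.transpose_mul, mul_assoc, ← mul_assoc (quatRight j),
    quatRight_mul_transpose, one_mul, quatLeft_mul_transpose]

/-- Multiplications by imaginary units are antisymmetric, and the left ones commute with the right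
ones, so the two signs cancel. -/
theorem quatConj_transpose {i j : Fin 4} (hi : i ≠ 0) (hj : j ≠ 0) :
    (quatConj i j).transpose = quatConj i j := by
  revert i j
  decide

theorem quatConj_zero_zero : quatConj 0 0 = 1 := by
  decide

theorem klein_klein (i j : Fin 4) : klein i (klein i j) = j := by
  revert i j
  decide

theorem klein_comm (i j : Fin 4) : klein i j = klein j i := by
  revert i j
  decide

theorem quatSign_mul_self (i j : Fin 4) : quatSign i j * quatSign i j = 1 := by
  revert i j
  decide

theorem quatSign_anticomm {i j : Fin 4} (hi : i ≠ 0) (hj : j ≠ 0) (hij : i ≠ j) :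
    quatSign i j = -quatSign j i := by
  revert i j
  decide

/-! ### Tensoring with integer matrices -/

section Tens

variable {n B : Type*} [Ring B]

/-- The matrix `G ⊗ x` over `B`, for an integer matrix `G` and an element `x` of `B`. -/
def tens (G : Matrix n n ℤ) (x : B) : Matrix n n B := Matrix.of fun r s => G r s • x

theorem tens_apply (G : Matrix n n ℤ) (x : B) (r s : n) : tens G x r s = G r s • x := rfl

theorem tens_mul [Fintype n] (G G' : Matrix n n ℤ) (x x' : B) :
    tens G x * tens G' x' = tens (G * G') (x * x') := by
  ext r s
  simp only [Matrix.mul_apply, tens_apply, smul_mul_smul_comm, Finset.sum_smul]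

theorem tens_zsmul (k : ℤ) (G : Matrix n n ℤ) (x : B) : tens (k • G) x = k • tens G x := by
  ext r s
  simp only [Matrix.smul_apply, tens_apply, smul_smul, smul_eq_mul]

theorem tens_sum {ι : Type*} (t : Finset ι) (G : Matrix n n ℤ) (f : ι → B) :
    tens G (∑ i ∈ t, f i) = ∑ i ∈ t, tens G (f i) := by
  ext r s
  simp only [Matrix.sum_apply, tens_apply, Finset.smul_sum]

theorem tens_neg (G : Matrix n n ℤ) (x : B) : tens G (-x) = -tens G x := by
  ext r s
  simp only [Matrix.neg_apply, tens_apply, smul_neg]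

theorem tens_zero (G : Matrix n n ℤ) : tens G (0 : B) = 0 := by
  ext r s
  simp only [tens_apply, smul_zero, Matrix.zero_apply]

theorem tens_one_one [DecidableEq n] : tens (1 : Matrix n n ℤ) (1 : B) = 1 := by
  ext r s
  simp only [tens_apply, Matrix.one_apply, ite_smul, one_smul, zero_smul]

theorem tens_map {B' : Type*} [Algebra ℂ B] [Ring B'] [Algebra ℂ B'] (φ : B →ₗ[ℂ] B')
    (G : Matrix n n ℤ) (x : B) :
    (tens G x).map φ = tens G (φ x) := by
  ext r s
  simp only [Matrix.map_apply, tens_apply, map_zsmul]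

end Tens

/-! ### Untwisting by quaternion conjugations -/

/-- The `4 × 4` matrix over `M_4(B)` that is obtained by untwisting a matrix of Fourier
coefficients. -/
def untwist {B : Type*} [Ring B] (a : Matrix (Fin 4) (Fin 4) B) :
    Matrix (Fin 4) (Fin 4) (Matrix (Fin 4) (Fin 4) B) :=
  Matrix.of fun i j => tens (quatConj i j) (a i j)

theorem untwist_apply {B : Type*} [Ring B] (a : Matrix (Fin 4) (Fin 4) B) (i j : Fin 4) :
    untwist a i j = tens (quatConj i j) (a i j) := rfl

theorem untwist_map {B B' : Type*} [Ring B] [Algebra ℂ B] [Ring B'] [Algebra ℂ B']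
    (φ : B →ₐ[ℂ] B') (a : Matrix (Fin 4) (Fin 4) B) :
    untwist (a.map φ) = (untwist a).map φ.mapMatrix := by
  refine Matrix.ext fun i j => ?_
  exact (tens_map φ.toLinearMap (quatConj i j) (a i j)).symm

/-- The relations that say that a matrix defines an endomorphism `e_j ↦ ∑ᵢ c_ij e_i` of the
quaternions. -/
structure IsQuatEnd {B : Type*} [Ring B] (c : Matrix (Fin 4) (Fin 4) B) : Prop where
  zero_zero : c 0 0 = 1
  zero_left : ∀ j ≠ 0, c 0 j = 0
  zero_right : ∀ i ≠ 0, c i 0 = 0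
  -- The sign of e_j e_k = ± e_{j+k} is moved to the left side, next to the sign of e_l e_{l+i} = ±
  -- e_i.
  mul : ∀ i j k, ∑ l, (quatSign l (klein l i) * quatSign j k) • (c l j * c (klein l i) k)
    = c i (klein j k)

namespace IsTwisted

variable {B : Type*} [Ring B] {a : Matrix (Fin 4) (Fin 4) B}

/-- The signs from multiplying the matrices `quatConj` are the very signs in `IsQuatEnd.mul`; they
square to 1, and what is left is the relation `IsTwisted.col`. -/
theorem isQuatEnd_untwist (h : IsTwisted a) : IsQuatEnd (untwist a) where
  zero_zero := by rw [untwist_apply, h.zero_zero, quatConj_zero_zero, tens_one_one]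
  zero_left j hj := by rw [untwist_apply, h.zero_left j hj, tens_zero]
  zero_right i hi := by rw [untwist_apply, h.zero_right i hi, tens_zero]
  mul i j k := by
    simp only [untwist_apply, tens_mul, quatConj_mul, tens_zsmul, smul_smul, klein_klein]
    rw [← h.col, tens_sum]
    refine Finset.sum_congr rfl fun l _ => ?_
    rw [mul_mul_mul_comm, quatSign_mul_self, quatSign_mul_self, one_mul, one_smul]

/-- For nonzero indices, swapping the factors changes the sign of `quatConj` once for each of i ≠ i'
and j ≠ j'. The coefficients anticommute exactly when one of these holds and not the other, so the
total sign is always +1. -/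
theorem commute_untwist (h : IsTwisted a) (i j i' j' : Fin 4) :
    Commute (untwist a i j) (untwist a i' j') := by
  have hz : ∀ i j, (i = 0 ∨ j = 0) → untwist a i j = 0 ∨ untwist a i j = 1 := by
    intro i j hij
    by_cases hi : i = 0
    · by_cases hj : j = 0
      · exact Or.inr (by rw [hi, hj, h.isQuatEnd_untwist.zero_zero])
      · exact Or.inl (by rw [hi, h.isQuatEnd_untwist.zero_left j hj])
    · exact Or.inl (by rw [hij.resolve_left hi, h.isQuatEnd_untwist.zero_right i hi])
  by_cases h0 : i = 0 ∨ j = 0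
  · rcases hz i j h0 with h1 | h1 <;> rw [h1]
    exacts [Commute.zero_left _, Commute.one_left _]
  by_cases h0' : i' = 0 ∨ j' = 0
  · rcases hz i' j' h0' with h1 | h1 <;> rw [h1]
    exacts [Commute.zero_right _, Commute.one_right _]
  push Not at h0 h0'
  obtain ⟨hi, hj⟩ := h0
  obtain ⟨hi', hj'⟩ := h0'
  change _ * _ = _ * _
  simp only [untwist_apply, tens_mul, quatConj_mul, tens_zsmul]
  rw [klein_comm i' i, klein_comm j' j]
  by_cases hii : i = i'
  · subst hii
    by_cases hjj : j = j'
    · rw [hjj]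
    · rw [h.row_anticomm hi hj hj' hjj, quatSign_anticomm hj hj' hjj, tens_neg, mul_neg, neg_smul,
        smul_neg, neg_neg]
  · by_cases hjj : j = j'
    · subst hjj
      rw [h.col_anticomm hi hi' hj hii, quatSign_anticomm hi hi' hii, tens_neg, neg_mul, neg_smul,
        smul_neg, neg_neg]
    · rw [h.comm hi hi' hii hj hj' hjj, quatSign_anticomm hi hi' hii, quatSign_anticomm hj hj' hjj,
        neg_mul_neg]

theorem conjTranspose_untwist [StarRing B] (h : IsTwisted a) (ha : ∀ i j, star (a i j) = a i j)
    (i j : Fin 4) : (untwist a i j).conjTranspose = untwist a i j := by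
  by_cases hi : i = 0
  · by_cases hj : j = 0
    · rw [hi, hj, h.isQuatEnd_untwist.zero_zero, Matrix.conjTranspose_one]
    · rw [hi, h.isQuatEnd_untwist.zero_left j hj, Matrix.conjTranspose_zero]
  · by_cases hj : j = 0
    · rw [hj, h.isQuatEnd_untwist.zero_right i hi, Matrix.conjTranspose_zero]
    · ext r s
      rw [Matrix.conjTranspose_apply, untwist_apply, tens_apply, tens_apply, star_zsmul, ha,
        ← quatConj_transpose hi hj, Matrix.transpose_apply, quatConj_transpose hi hj]

end IsTwisted

/-- The magic matrix over `M_4(B)` that is attached to a matrix over a commutative algebra `B`. -/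
def quatModel {B : Type*} [Ring B] [Algebra ℂ B] (c : Matrix (Fin 4) (Fin 4) B) :
    Matrix (Fin 4) (Fin 4) (Matrix (Fin 4) (Fin 4) B) :=
  fourier (untwist c)

theorem quatModel_map {B B' : Type*} [Ring B] [Algebra ℂ B] [Ring B'] [Algebra ℂ B']
    (φ : B →ₐ[ℂ] B') (c : Matrix (Fin 4) (Fin 4) B) :
    quatModel (c.map φ) = (quatModel c).map φ.mapMatrix := by
  rw [quatModel, quatModel, untwist_map]
  exact fourier_map (φ.mapMatrix (m := Fin 4)).toLinearMap (untwist c)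

theorem eval_quatModel_map {B B' : Type*} [Ring B] [Algebra ℂ B] [Ring B'] [Algebra ℂ B']
    (φ : B →ₐ[ℂ] B') (c : Matrix (Fin 4) (Fin 4) B) (P : FreeAlgebra ℂ (Fin 4 × Fin 4)) :
    eval (quatModel (c.map φ)) P = φ.mapMatrix (eval (quatModel c) P) := by
  rw [quatModel_map, ← eval_map]

/-! ### The invariant vector of the doubled quaternion representation -/

section Bell

variable {B : Type*} [Ring B] [Algebra ℂ B]

/-- The value of a matrix over `M_4(B)` at the vector `∑ₛ e_s ⊗ e_s`. -/
def bellApply (Y : Matrix (Fin 4) (Fin 4) (Matrix (Fin 4) (Fin 4) B)) (r r' : Fin 4) : B :=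
  ∑ s, Y r s r' s

/-- Two untwistings put G ⊗ G in front of a coefficient, with G = `quatConj k l`. Contracting over s
gives G Gᵀ = 1, so the vector ∑ₛ e_s ⊗ e_s is carried to itself times the coefficient. -/
theorem sum_quatModel_untwist (a : Matrix (Fin 4) (Fin 4) B) (i j r r' : Fin 4) :
    bellApply (quatModel (untwist a) i j) r r' = if r = r' then fourier a i j else 0 := by
  have h1 : ∀ k l, bellApply (tens (quatConj k l) (untwist a k l)) r r'
      = if r = r' then a k l else 0 := fun k l => by
    have h2 := congrFun (congrFun (quatConj_mul_transpose k l) r) r'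
    simp only [Matrix.mul_apply, Matrix.transpose_apply, Matrix.one_apply] at h2
    simp only [bellApply, tens_apply, Matrix.smul_apply, untwist_apply, smul_smul]
    rw [← Finset.sum_smul, h2, ite_smul, one_smul, zero_smul]
  simp only [quatModel, fourier_apply, bellApply, Matrix.smul_apply, Matrix.sum_apply,
    untwist_apply (untwist a)]
  rw [← Finset.smul_sum, Finset.sum_comm]
  simp only [bellApply] at h1
  have h3 : ∀ k, ∑ s, ∑ l, (hadamard k i * hadamard l j) •
      tens (quatConj k l) (untwist a k l) r s r' s
      = ∑ l, (hadamard k i * hadamard l j) • if r = r' then a k l else 0 := fun k => by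
    rw [Finset.sum_comm]
    exact Finset.sum_congr rfl fun l _ => by rw [← Finset.smul_sum, h1]
  rw [Finset.sum_congr rfl fun k _ => h3 k]
  split_ifs <;> simp

theorem bellApply_mul (a : Matrix (Fin 4) (Fin 4) B)
    (Y : Matrix (Fin 4) (Fin 4) (Matrix (Fin 4) (Fin 4) B)) (i j r r' : Fin 4) :
    bellApply (Y * quatModel (untwist a) i j) r r' = bellApply Y r r' * fourier a i j := by
  have h1 : ∀ s, (Y * quatModel (untwist a) i j) r s r' s
      = ∑ t, ∑ t', Y r t r' t' * quatModel (untwist a) i j t s t' s := fun s => by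
    simp only [Matrix.mul_apply, Matrix.sum_apply]
  have h2 := sum_quatModel_untwist a i j
  simp only [bellApply] at h2 ⊢
  simp only [h1]
  rw [Finset.sum_comm, Finset.sum_mul]
  refine Finset.sum_congr rfl fun t _ => ?_
  rw [Finset.sum_comm]
  simp only [← Finset.mul_sum, h2, mul_ite, mul_zero, Finset.sum_ite_eq, Finset.mem_univ, if_true]

/-- The left factor `Y` is kept arbitrary so that in the product case the value of the first
polynomial can be absorbed into it. -/
theorem bellApply_mul_eval (a : Matrix (Fin 4) (Fin 4) B) (P : FreeAlgebra ℂ (Fin 4 × Fin 4)) :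
    ∀ (Y : Matrix (Fin 4) (Fin 4) (Matrix (Fin 4) (Fin 4) B)) (r r' : Fin 4),
      bellApply (Y * eval (quatModel (untwist a)) P) r r'
        = bellApply Y r r' * eval (fourier a) P := by
  induction P using FreeAlgebra.induction with
  | grade0 c =>
    intro Y r r'
    simp only [eval, AlgHom.commutes, ← Algebra.commutes c, ← Algebra.smul_def]
    simp only [bellApply, Matrix.smul_apply, Finset.smul_sum]
  | grade1 ij =>
    intro Y r r'
    simp only [eval, FreeAlgebra.lift_ι_apply, bellApply_mul]
  | mul P Q hP hQ =>
    intro Y r r'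
    have h1 : ∀ {D : Type _} [Ring D] [Algebra ℂ D] (N : Matrix (Fin 4) (Fin 4) D),
      eval N (P * Q) = eval N P * eval N Q := fun N => map_mul _ P Q
    rw [h1, ← mul_assoc, hQ, hP, mul_assoc]
    congr 1
    exact (map_mul _ P Q).symm
  | add P Q hP hQ =>
    intro Y r r'
    have h1 : ∀ {D : Type _} [Ring D] [Algebra ℂ D] (N : Matrix (Fin 4) (Fin 4) D),
      eval N (P + Q) = eval N P + eval N Q := fun N => map_add _ P Q
    have h2 : ∀ Y Y' : Matrix (Fin 4) (Fin 4) (Matrix (Fin 4) (Fin 4) B),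
        bellApply (Y + Y') r r' = bellApply Y r r' + bellApply Y' r r' := fun Y Y' => by
      simp only [bellApply, Matrix.add_apply, Finset.sum_add_distrib]
    rw [h1, mul_add, h2, hP, hQ, ← mul_add]
    congr 1
    exact (map_add _ P Q).symm

/-- The coordinate at r = r' = 0 of ∑ₛ e_s ⊗ e_s is 1, so it returns the value itself. For a =
`fourier m` that value is P(m), as the transform is an involution. -/
theorem eval_fourier_eq_zero {a : Matrix (Fin 4) (Fin 4) B} {P : FreeAlgebra ℂ (Fin 4 × Fin 4)}
    (h : eval (quatModel (untwist a)) P = 0) : eval (fourier a) P = 0 := by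
  have h1 := bellApply_mul_eval a P 1 0 0
  rw [h, mul_zero] at h1
  have h2 : bellApply (1 : Matrix (Fin 4) (Fin 4) (Matrix (Fin 4) (Fin 4) B)) 0 0 = 1 := by
    simp [bellApply, Fin.sum_univ_four]
  rw [h2, one_mul] at h1
  rw [← h1]
  simp [bellApply]

end Bell

/-! ### Reduction to scalar quaternion automorphisms -/

theorem IsQuatEnd.map {B B' : Type*} [Ring B] [Algebra ℂ B] [Ring B'] [Algebra ℂ B']
    {c : Matrix (Fin 4) (Fin 4) B} (h : IsQuatEnd c) (φ : B →ₐ[ℂ] B') : IsQuatEnd (c.map φ) where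
  zero_zero := by rw [Matrix.map_apply, h.zero_zero, map_one]
  zero_left j hj := by rw [Matrix.map_apply, h.zero_left j hj, map_zero]
  zero_right i hi := by rw [Matrix.map_apply, h.zero_right i hi, map_zero]
  mul i j k := by simp only [Matrix.map_apply, ← map_mul, ← map_zsmul, ← map_sum, h.mul]

theorem IsQuatEnd.of_map {B B' : Type*} [Ring B] [Algebra ℂ B] [Ring B'] [Algebra ℂ B']
    {c : Matrix (Fin 4) (Fin 4) B} {φ : B →ₐ[ℂ] B'} (h : IsQuatEnd (c.map φ))
    (hφ : Function.Injective φ) : IsQuatEnd c where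
  zero_zero := hφ (by rw [map_one]; exact h.zero_zero)
  zero_left j hj := hφ (by rw [map_zero]; exact h.zero_left j hj)
  zero_right i hi := hφ (by rw [map_zero]; exact h.zero_right i hi)
  mul i j k := hφ (by simpa only [map_sum, map_zsmul, map_mul, Matrix.map_apply] using h.mul i j k)

section

open WeakDual

theorem eq_zero_of_forall_character {S : Type*} [CommCStarAlgebra S] {s : S}
    (h : ∀ φ : characterSpace ℂ S, φ s = 0) : s = 0 :=
  (gelfandTransform_isometry S).injective <| by
    rw [map_zero]
    ext φ
    exact h φ

/-- A character carries `c` to a real scalar quaternion endomorphism and commutes with the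
evaluation. Characters separate points, so each entry vanishes. -/
theorem eval_quatModel_eq_zero_of_comm {S : Type*} [CommCStarAlgebra S]
    {c : Matrix (Fin 4) (Fin 4) S} (hc : IsQuatEnd c) (hs : ∀ i j, star (c i j) = c i j)
    {P : FreeAlgebra ℂ (Fin 4 × Fin 4)}
    (hP : ∀ x : Matrix (Fin 4) (Fin 4) ℂ, IsQuatEnd x → (∀ i j, star (x i j) = x i j) →
      eval (quatModel x) P = 0) : eval (quatModel c) P = 0 := by
  ext r s
  refine eq_zero_of_forall_character fun φ => ?_
  have h := eval_quatModel_map (φ : S →ₐ[ℂ] ℂ) c P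
  rw [hP _ (hc.map _) fun i j => ?_] at h
  · exact (congrFun (congrFun h r) s).symm
  · rw [Matrix.map_apply]
    change star (φ (c i j)) = φ (c i j)
    rw [← map_star, hs]

theorem eval_quatModel_eq_zero_of_commute {D : Type*} [CStarAlgebra D]
    {c : Matrix (Fin 4) (Fin 4) D} (hc : IsQuatEnd c) (hs : ∀ i j, star (c i j) = c i j)
    (hcomm : ∀ i j i' j', Commute (c i j) (c i' j')) {P : FreeAlgebra ℂ (Fin 4 × Fin 4)}
    (hP : ∀ x : Matrix (Fin 4) (Fin 4) ℂ, IsQuatEnd x → (∀ i j, star (x i j) = x i j) →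
      eval (quatModel x) P = 0) : eval (quatModel c) P = 0 := by
  set t : Set D := Set.range fun ij : Fin 4 × Fin 4 => c ij.1 ij.2
  have h1 : IsMulCommutative (StarAlgebra.adjoin ℂ t) := StarAlgebra.isMulCommutative_adjoin ℂ
    (by rintro _ ⟨i, rfl⟩ _ ⟨j, rfl⟩; exact hcomm _ _ _ _)
    (by rintro _ ⟨i, rfl⟩ _ ⟨j, rfl⟩; rw [hs]; exact hcomm _ _ _ _)
  -- The closed *-algebra generated by commuting self-adjoint entries is a commutative C*-algebra,
  -- so Gelfand duality applies to the entries inside it.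
  let S := (StarAlgebra.adjoin ℂ t).topologicalClosure
  have hS : IsClosed (S : Set D) := StarSubalgebra.isClosed_topologicalClosure _
  let _ : CommCStarAlgebra S :=
    { StarSubalgebra.cstarAlgebra S with
      mul_comm := (StarSubalgebra.commRingTopologicalClosure (StarAlgebra.adjoin ℂ t)
        fun x y => mul_comm' x y).mul_comm }
  let c' : Matrix (Fin 4) (Fin 4) S := Matrix.of fun i j => ⟨c i j,
    StarSubalgebra.le_topologicalClosure _ (StarAlgebra.subset_adjoin ℂ t ⟨(i, j), rfl⟩)⟩
  have h2 : c = c'.map S.subtype.toAlgHom := rfl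
  have h3 : IsQuatEnd c' := IsQuatEnd.of_map (φ := S.subtype.toAlgHom) hc Subtype.val_injective
  rw [h2, eval_quatModel_map,
    eval_quatModel_eq_zero_of_comm h3 (fun i j => Subtype.ext (hs i j)) hP, map_zero]

end

/-- The untwisted coefficients live in M_4(C), which gets its C*-norm as `CStarMatrix`; the
relations are transported there and the vanishing is brought back. -/
theorem eval_eq_zero_of_forall_quatEnd {C : Type*} [CStarAlgebra C] {m : Matrix (Fin 4) (Fin 4) C}
    (hm : IsMagic m) {P : FreeAlgebra ℂ (Fin 4 × Fin 4)}
    (hP : ∀ x : Matrix (Fin 4) (Fin 4) ℂ, IsQuatEnd x → (∀ i j, star (x i j) = x i j) →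
      eval (quatModel x) P = 0) : eval m P = 0 := by
  let _ : PartialOrder C := CStarAlgebra.spectralOrder C
  have _ : StarOrderedRing C := CStarAlgebra.spectralOrderedRing C
  have ha := hm.isTwisted
  let e : Matrix (Fin 4) (Fin 4) C ≃⋆ₐ[ℂ] CStarMatrix (Fin 4) (Fin 4) C :=
    CStarMatrix.ofMatrixStarAlgEquiv
  let ι : Matrix (Fin 4) (Fin 4) C →ₐ[ℂ] CStarMatrix (Fin 4) (Fin 4) C :=
    (e : Matrix (Fin 4) (Fin 4) C →⋆ₐ[ℂ] CStarMatrix (Fin 4) (Fin 4) C).toAlgHom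
  have h1 := eval_quatModel_eq_zero_of_commute (ha.isQuatEnd_untwist.map ι)
    (fun i j => congrArg ι (ha.conjTranspose_untwist hm.star_fourier i j))
    (fun i j i' j' => (ha.commute_untwist i j i' j').map ι) hP
  rw [eval_quatModel_map] at h1
  have h2 : eval (quatModel (untwist (fourier m))) P = 0 := by
    refine Matrix.ext fun r s => ?_
    exact e.injective ((congrFun (congrFun h1 r) s).trans (map_zero e).symm)
  have h3 := eval_fourier_eq_zero h2
  rwa [fourier_fourier] at h3

/-! ### Euler angles -/

/-- The rotation `(x, y, z) ↦ (y, c x + s z, s x - c z)`, extended by `1` to the quaternions. -/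
def quatRotation (c s : ℝ) : Matrix (Fin 4) (Fin 4) ℂ :=
  !![1, 0, 0, 0; 0, 0, 1, 0; 0, (c : ℂ), 0, (s : ℂ); 0, (s : ℂ), 0, -(c : ℂ)]

/-- The rotation `(x, y, z) ↦ (y, c x + s z, s x - c z)`. -/
def rotation (c s : ℝ) : Matrix (Fin 3) (Fin 3) ℝ := !![0, 1, 0; c, 0, s; s, 0, -c]

theorem exists_unit_mul_eq_mul (a b : ℝ) : ∃ c s : ℝ, c ^ 2 + s ^ 2 = 1 ∧ c * a + s * b = 0 := by
  by_cases h : a ^ 2 + b ^ 2 = 0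
  · exact ⟨1, 0, by norm_num, by nlinarith [sq_nonneg a, sq_nonneg b]⟩
  · have hp : 0 < a ^ 2 + b ^ 2 := lt_of_le_of_ne (by positivity) (Ne.symm h)
    have hs : √(a ^ 2 + b ^ 2) ^ 2 = a ^ 2 + b ^ 2 := Real.sq_sqrt hp.le
    have hn : √(a ^ 2 + b ^ 2) ≠ 0 := (Real.sqrt_pos.2 hp).ne'
    -- The vector (a, b), turned by a right angle and normalized.
    refine ⟨b / √(a ^ 2 + b ^ 2), -a / √(a ^ 2 + b ^ 2), ?_, by ring⟩
    rw [div_pow, div_pow, hs, ← add_div, neg_sq, add_comm, div_self h]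

theorem rotation_mul_transpose {c s : ℝ} (h : c ^ 2 + s ^ 2 = 1) :
    rotation c s * (rotation c s).transpose = 1 := by
  ext i j
  fin_cases i <;> fin_cases j <;>
    simp [rotation, Matrix.mul_apply, Fin.sum_univ_three] <;> linarith

theorem det_rotation {c s : ℝ} (h : c ^ 2 + s ^ 2 = 1) : (rotation c s).det = 1 := by
  simp [rotation, Matrix.det_fin_three]
  linarith

/-- A rotation matrix whose first row is `(0, 1, 0)` is one of the matrices `rotation c s`. -/
theorem exists_eq_rotation {X : Matrix (Fin 3) (Fin 3) ℝ} (h : X * X.transpose = 1)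
    (hd : X.det = 1) (h0 : X 0 0 = 0) (h1 : X 0 1 = 1) (h2 : X 0 2 = 0) :
    ∃ c s : ℝ, c ^ 2 + s ^ 2 = 1 ∧ X = rotation c s := by
  have ha : ∀ i j, ∑ k, X i k * X j k = if i = j then 1 else 0 := fun i j => by
    have := congrFun (congrFun h i) j
    simpa only [Matrix.mul_apply, Matrix.transpose_apply, Matrix.one_apply] using this
  simp only [Fin.sum_univ_three] at ha
  have h01 := ha 0 1
  have h02 := ha 0 2
  have h11 := ha 1 1
  have h12 := ha 1 2
  have h22 := ha 2 2
  simp [h0, h1, h2] at h01 h02 h11 h12 h22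
  rw [h01] at h11 h12
  rw [h02] at h12 h22
  rw [Matrix.det_fin_three, h0, h1, h2] at hd
  -- The sum is |row 1|² + |row 2|² − 2 det X = 1 + 1 − 2.
  have e0 : (X 1 2 - X 2 0) ^ 2 + (X 2 2 + X 1 0) ^ 2 = 0 := by linarith
  have e1 : X 1 2 = X 2 0 := sub_eq_zero.1 (pow_eq_zero_iff two_ne_zero |>.1 (by nlinarith))
  have e2 : X 2 2 = -X 1 0 :=
    eq_neg_of_add_eq_zero_left (pow_eq_zero_iff two_ne_zero |>.1 (by nlinarith))
  refine ⟨X 1 0, X 2 0, by rw [← e1]; nlinarith, ?_⟩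
  ext i j
  fin_cases i <;> fin_cases j <;> simp [rotation, h0, h1, h2, h01, h02, e1, e2]

/-- Euler angles: the left factor is chosen to clear the entry (0, 1), which leaves a unit first row
(Y₀₀, 0, Y₀₂). Its entries give the right factor, and the first row of what lies between is (0, 1,
0). -/
theorem exists_eq_rotation_mul {X : Matrix (Fin 3) (Fin 3) ℝ} (h : X * X.transpose = 1)
    (hd : X.det = 1) : ∃ c₁ s₁ c₂ s₂ c₃ s₃ : ℝ, c₁ ^ 2 + s₁ ^ 2 = 1 ∧ c₂ ^ 2 + s₂ ^ 2 = 1 ∧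
      c₃ ^ 2 + s₃ ^ 2 = 1 ∧ X = rotation c₁ s₁ * rotation c₂ s₂ * rotation c₃ s₃ := by
  obtain ⟨c₁, s₁, hcs₁, h₁⟩ := exists_unit_mul_eq_mul (X 1 1) (X 2 1)
  set Y := (rotation c₁ s₁).transpose * X with hY
  have hXY : X = rotation c₁ s₁ * Y := by
    rw [hY, ← mul_assoc, rotation_mul_transpose hcs₁, one_mul]
  have hYY : Y * Y.transpose = 1 := by
    rw [hY, Matrix.transpose_mul, Matrix.transpose_transpose, mul_assoc, ← mul_assoc X, h, one_mul]
    exact mul_eq_one_comm.1 (rotation_mul_transpose hcs₁)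
  have hYd : Y.det = 1 := by
    rw [hY, Matrix.det_mul, Matrix.det_transpose, det_rotation hcs₁, hd, one_mul]
  have hY1 : Y 0 1 = 0 := by
    rw [← h₁, hY]
    simp [rotation, Matrix.mul_apply, Fin.sum_univ_three]
  have hcs₃ : Y 0 0 ^ 2 + Y 0 2 ^ 2 = 1 := by
    have h2 := congrFun (congrFun hYY 0) 0
    simp only [Matrix.mul_apply, Matrix.transpose_apply, Matrix.one_apply, Fin.sum_univ_three, hY1,
      if_true] at h2
    linarith
  set Z := Y * (rotation (Y 0 0) (Y 0 2)).transpose with hZ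
  have hYZ : Y = Z * rotation (Y 0 0) (Y 0 2) := by
    rw [hZ, mul_assoc, mul_eq_one_comm.1 (rotation_mul_transpose hcs₃), mul_one]
  have hZZ : Z * Z.transpose = 1 := by
    rw [hZ, Matrix.transpose_mul, Matrix.transpose_transpose, mul_assoc,
      ← mul_assoc _ (rotation (Y 0 0) (Y 0 2)),
      mul_eq_one_comm.1 (rotation_mul_transpose hcs₃), one_mul, hYY]
  have hZd : Z.det = 1 := by
    rw [hZ, Matrix.det_mul, Matrix.det_transpose, det_rotation hcs₃, hYd, one_mul]
  have hZ0 : Z 0 0 = 0 ∧ Z 0 1 = 1 ∧ Z 0 2 = 0 := by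
    simp only [hZ, Matrix.mul_apply, Matrix.transpose_apply, Fin.sum_univ_three, hY1]
    refine ⟨?_, ?_, ?_⟩ <;> simp [rotation] <;> linarith
  obtain ⟨c₂, s₂, hcs₂, h₂⟩ := exists_eq_rotation hZZ hZd hZ0.1 hZ0.2.1 hZ0.2.2
  exact ⟨c₁, s₁, c₂, s₂, Y 0 0, Y 0 2, hcs₁, hcs₂, hcs₃, by rw [← h₂, mul_assoc, ← hYZ, ← hXY]⟩

/-- Every automorphism of the quaternions is a product of three of the basic rotations. -/
theorem IsQuatEnd.exists_eq_quatRotation_mul {x : Matrix (Fin 4) (Fin 4) ℂ} (h : IsQuatEnd x)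
    (hs : ∀ i j, star (x i j) = x i j) : ∃ c₁ s₁ c₂ s₂ c₃ s₃ : ℝ, c₁ ^ 2 + s₁ ^ 2 = 1 ∧
      c₂ ^ 2 + s₂ ^ 2 = 1 ∧ c₃ ^ 2 + s₃ ^ 2 = 1 ∧
      x = quatRotation c₁ s₁ * quatRotation c₂ s₂ * quatRotation c₃ s₃ := by
  set X : Matrix (Fin 3) (Fin 3) ℝ := Matrix.of fun i j => (x i.succ j.succ).re with hX
  have hx : ∀ i j : Fin 3, x i.succ j.succ = (X i j : ℂ) := fun i j =>
    (Complex.conj_eq_iff_re.1 (hs _ _)).symm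
  have x11 : x 1 1 = X 0 0 := hx 0 0
  have x12 : x 1 2 = X 0 1 := hx 0 1
  have x13 : x 1 3 = X 0 2 := hx 0 2
  have x21 : x 2 1 = X 1 0 := hx 1 0
  have x22 : x 2 2 = X 1 1 := hx 1 1
  have x23 : x 2 3 = X 1 2 := hx 1 2
  have x31 : x 3 1 = X 2 0 := hx 2 0
  have x32 : x 3 2 = X 2 1 := hx 2 1
  have x33 : x 3 3 = X 2 2 := hx 2 2
  have x01 : x 0 1 = 0 := h.zero_left 1 (by decide)
  have x02 : x 0 2 = 0 := h.zero_left 2 (by decide)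
  have x03 : x 0 3 = 0 := h.zero_left 3 (by decide)
  have x10 : x 1 0 = 0 := h.zero_right 1 (by decide)
  have x20 : x 2 0 = 0 := h.zero_right 2 (by decide)
  have x30 : x 3 0 = 0 := h.zero_right 3 (by decide)
  -- The e_0-component of multiplicativity says that the columns are orthonormal.
  have hXX : X.transpose * X = 1 := by
    ext j k
    have h1 := h.mul 0 j.succ k.succ
    rw [Matrix.mul_apply, Fin.sum_univ_three]
    simp only [Matrix.transpose_apply]
    fin_cases j <;> fin_cases k <;>
      simp [Fin.sum_univ_four, klein, quatSign, x11, x12, x13, x21, x22, x23, x31, x32, x33, x01,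
        x02, x03, h.zero_zero] at h1 ⊢ <;>
      norm_cast at h1 <;> linarith
  have hXX' : X * X.transpose = 1 := mul_eq_one_comm.1 hXX
  have hd : X.det = 1 := by
    -- The e_3-component expresses the last row by the 2 × 2 minors of the other two, so expanding
    -- the determinant along it gives its squared length 1.
    have h1 := h.mul 3 2 3
    have h2 := h.mul 3 3 1
    have h3 := h.mul 3 1 2
    have h4 := congrFun (congrFun hXX' 2) 2
    simp [Fin.sum_univ_four, klein, quatSign, x11, x12, x13, x21, x22, x23, x31, x32, x33, x01,
      x02, x03] at h1 h2 h3
    simp [Matrix.mul_apply, Fin.sum_univ_three] at h4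
    norm_cast at h1 h2 h3
    rw [Matrix.det_fin_three]
    linear_combination h4 + X 2 0 * h1 + X 2 1 * h2 + X 2 2 * h3
  obtain ⟨c₁, s₁, c₂, s₂, c₃, s₃, h₁, h₂, h₃, he⟩ := exists_eq_rotation_mul hXX' hd
  refine ⟨c₁, s₁, c₂, s₂, c₃, s₃, h₁, h₂, h₃, ?_⟩
  ext i j
  fin_cases i <;> fin_cases j <;>
    simp [quatRotation, Matrix.mul_apply, Fin.sum_univ_four, x01, x02, x03, x10, x20, x30,
      h.zero_zero, x11, x12, x13, x21, x22, x23, x31, x32, x33, he, rotation]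

/-! ### Representations of `A` by Pauli matrices -/

section

variable {D : Type*} [Ring D] [Algebra ℂ D]

/-- The element `(1 + c X + s Z) / 2`, a projection if `X` and `Z` are anticommuting symmetries. -/
def pauliProj (c s : ℝ) (X Z : D) : D := (2⁻¹ : ℂ) • (1 + ((c : ℂ) • X + (s : ℂ) • Z))

/-- The Fourier coefficients of the image of `R` under a representation by Pauli matrices. -/
def pauliFourier (c s : ℝ) (X Z : D) : Matrix (Fin 4) (Fin 4) D :=
  !![1, 0, 0, 0; 0, 0, 1, 0; 0, (c : ℂ) • X, 0, (s : ℂ) • Z; 0, (s : ℂ) • Z, 0, (c : ℂ) • X]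

theorem pauliFourier_map {D' : Type*} [Ring D'] [Algebra ℂ D'] (φ : D →ₐ[ℂ] D')
    (c s : ℝ) (X Z : D) : (pauliFourier c s X Z).map φ = pauliFourier c s (φ X) (φ Z) := by
  refine Matrix.ext fun i j => ?_
  fin_cases i <;> fin_cases j <;>
    first
    | exact map_zero φ
    | exact map_one φ
    | exact map_smul φ _ _

/-- The right side is `R` with p and q replaced by the projections for (c, s) and (c, −s). The
coefficients come out because p + q − 1 = cX and p − q = sZ. -/
theorem fourier_pauliFourier (c s : ℝ) (X Z : D) : fourier (pauliFourier c s X Z) =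
    !![pauliProj c s X Z, 0, 1 - pauliProj c s X Z, 0;
       1 - pauliProj c s X Z, 0, pauliProj c s X Z, 0;
       0, pauliProj c (-s) X Z, 0, 1 - pauliProj c (-s) X Z;
       0, 1 - pauliProj c (-s) X Z, 0, pauliProj c (-s) X Z] := by
  ext i j
  fin_cases i <;> fin_cases j <;>
    simp [fourier_apply, hadamard, Fin.sum_univ_four, pauliFourier, pauliProj] <;> module

theorem commute_pauliProj {c s c' s' : ℝ} {X Z X' Z' : D} (hXX : Commute X X')
    (hXZ : Commute X Z') (hZX : Commute Z X') (hZZ : Commute Z Z') :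
    Commute (pauliProj c s X Z) (pauliProj c' s' X' Z') := by
  have h1 : ∀ Y : D, Commute Y X' → Commute Y Z' → Commute Y (pauliProj c' s' X' Z') :=
    fun Y hX hZ => ((Commute.one_right Y).add_right
      ((hX.smul_right (c' : ℂ)).add_right (hZ.smul_right (s' : ℂ)))).smul_right (2⁻¹ : ℂ)
  exact ((Commute.one_left _).add_left (((h1 X hXX hXZ).smul_left (c : ℂ)).add_left
    ((h1 Z hZX hZZ).smul_left (s : ℂ)))).smul_left (2⁻¹ : ℂ)

/-- Anticommutation cancels the cross terms, so cX + sZ squares to c² + s² = 1. -/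
theorem pauliProj_mul_self {c s : ℝ} (hcs : c ^ 2 + s ^ 2 = 1) {X Z : D} (hX : X * X = 1)
    (hZ : Z * Z = 1) (hXZ : Z * X = -(X * Z)) :
    pauliProj c s X Z * pauliProj c s X Z = pauliProj c s X Z := by
  have hcs' : (c : ℂ) ^ 2 + (s : ℂ) ^ 2 = 1 := by exact_mod_cast hcs
  have h1 : ((c : ℂ) • X + (s : ℂ) • Z) * ((c : ℂ) • X + (s : ℂ) • Z) = 1 := by
    simp only [mul_add, add_mul, smul_mul_smul_comm, hX, hZ, hXZ]
    trans ((c : ℂ) ^ 2 + (s : ℂ) ^ 2) • (1 : D)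
    · module
    · rw [hcs', one_smul]
  rw [pauliProj]
  generalize (c : ℂ) • X + (s : ℂ) • Z = Y at h1
  rw [smul_mul_smul_comm, add_mul, mul_add, mul_add, h1, one_mul, mul_one, one_mul]
  module

theorem star_pauliProj [StarRing D] [StarModule ℂ D] (c s : ℝ) {X Z : D} (hX : star X = X)
    (hZ : star Z = Z) : star (pauliProj c s X Z) = pauliProj c s X Z := by
  simp [pauliProj, hX, hZ]

end

section

variable {C : Type*} [CStarAlgebra C]

/-- A pair of anticommuting symmetries. -/
structure IsPauli (X Z : C) : Prop where
  mul_self_left : X * X = 1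
  mul_self_right : Z * Z = 1
  anticomm : Z * X = -(X * Z)
  star_left : star X = X
  star_right : star Z = Z

/-- The representation of `A` that is given by an angle and a pair of anticommuting symmetries. -/
def pauliRep {X Z : C} (h : IsPauli X Z) {c s : ℝ} (hcs : c ^ 2 + s ^ 2 = 1) : TwoProj →⋆ₐ[ℂ] C :=
  twoProjLift (pauliProj c s X Z) (pauliProj c (-s) X Z)
    (pauliProj_mul_self hcs h.mul_self_left h.mul_self_right h.anticomm)
    (pauliProj_mul_self (by rwa [neg_sq]) h.mul_self_left h.mul_self_right h.anticomm)
    (star_pauliProj c s h.star_left h.star_right) (star_pauliProj c (-s) h.star_left h.star_right)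

theorem map_pauliRep_R {X Z : C} (h : IsPauli X Z) {c s : ℝ} (hcs : c ^ 2 + s ^ 2 = 1) :
    R.map (pauliRep h hcs) = fourier (pauliFourier c s X Z) := by
  have hp : pauliRep h hcs p = pauliProj c s X Z := twoProjLift_p _ _ _ _ _ _
  have hq : pauliRep h hcs q = pauliProj c (-s) X Z := twoProjLift_q _ _ _ _ _ _
  rw [fourier_pauliFourier, ← hp, ← hq]
  ext i j
  fin_cases i <;> fin_cases j <;> simp [R]

theorem commute_pauliRep {X Z X' Z' : C} (h : IsPauli X Z) (h' : IsPauli X' Z') {c s c' s' : ℝ}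
    (hcs : c ^ 2 + s ^ 2 = 1) (hcs' : c' ^ 2 + s' ^ 2 = 1) (hXX : Commute X X')
    (hXZ : Commute X Z') (hZX : Commute Z X') (hZZ : Commute Z Z') (x y : TwoProj) :
    Commute (pauliRep h hcs x) (pauliRep h' hcs' y) := by
  have hp : pauliRep h hcs p = pauliProj c s X Z := twoProjLift_p _ _ _ _ _ _
  have hq : pauliRep h hcs q = pauliProj c (-s) X Z := twoProjLift_q _ _ _ _ _ _
  have hp' : pauliRep h' hcs' p = pauliProj c' s' X' Z' := twoProjLift_p _ _ _ _ _ _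
  have hq' : pauliRep h' hcs' q = pauliProj c' (-s') X' Z' := twoProjLift_q _ _ _ _ _ _
  refine commute_of_commute_generators _ _ ?_ ?_ ?_ ?_ x y <;> simp only [hp, hq, hp', hq'] <;>
    exact commute_pauliProj hXX hXZ hZX hZZ

/-- If a polynomial vanishes at `M`, it vanishes at the magic unitary that is attached to three
angles and three commuting pairs of anticommuting symmetries. -/
theorem eval_fourier_pauliFourier {X Z : Fin 3 → C} (h : ∀ k, IsPauli (X k) (Z k))
    (hXX : ∀ k l, k ≠ l → Commute (X k) (X l)) (hXZ : ∀ k l, k ≠ l → Commute (X k) (Z l))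
    (hZZ : ∀ k l, k ≠ l → Commute (Z k) (Z l)) {c s : Fin 3 → ℝ}
    (hcs : ∀ k, c k ^ 2 + s k ^ 2 = 1) {P : FreeAlgebra ℂ (Fin 4 × Fin 4)} (hP : eval M P = 0) :
    eval (fourier (pauliFourier (c 0) (s 0) (X 0) (Z 0) * pauliFourier (c 1) (s 1) (X 1) (Z 1) *
      pauliFourier (c 2) (s 2) (X 2) (Z 2))) P = 0 := by
  have hc : ∀ k l, k ≠ l → ∀ x y, Commute (pauliRep (h k) (hcs k) x) (pauliRep (h l) (hcs l) y) :=
    fun k l hkl => commute_pauliRep _ _ _ _ (hXX k l hkl) (hXZ k l hkl) (hXZ l k hkl.symm).symm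
      (hZZ k l hkl)
  rw [fourier_mul, fourier_mul, ← map_pauliRep_R (h 0) (hcs 0), ← map_pauliRep_R (h 1) (hcs 1),
    ← map_pauliRep_R (h 2) (hcs 2)]
  exact eval_map_mul_map_mul_map _ _ _ (hc 0 1 (by decide)) (hc 0 2 (by decide))
    (hc 1 2 (by decide)) hP

end

/-! ### Pauli matrices on three tensor factors -/

/-- The Pauli matrix `X` in the `k`-th of three tensor factors. -/
def pauliX (k : Fin 3) : Matrix (Fin 8) (Fin 8) ℤ :=
  -- Basis indices are read in binary, with tensor factor 0 as the highest bit; X flips the bit and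
  -- Z takes its sign.
  Matrix.of fun r s => if r.val ^^^ ![4, 2, 1] k = s.val then 1 else 0

/-- The Pauli matrix `Z` in the `k`-th of three tensor factors. -/
def pauliZ (k : Fin 3) : Matrix (Fin 8) (Fin 8) ℤ :=
  Matrix.diagonal fun r => if r.val.testBit (![2, 1, 0] k) then -1 else 1

theorem pauliX_mul_self (k : Fin 3) : pauliX k * pauliX k = 1 := by
  revert k
  decide +kernel

theorem pauliZ_mul_self (k : Fin 3) : pauliZ k * pauliZ k = 1 := by
  revert k
  decide +kernel

theorem pauliZ_mul_pauliX (k : Fin 3) : pauliZ k * pauliX k = -(pauliX k * pauliZ k) := by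
  revert k
  decide +kernel

theorem pauliX_transpose (k : Fin 3) : (pauliX k).transpose = pauliX k := by
  revert k
  decide +kernel

theorem pauliZ_transpose (k : Fin 3) : (pauliZ k).transpose = pauliZ k :=
  Matrix.diagonal_transpose _

theorem commute_pauliX (k l : Fin 3) : Commute (pauliX k) (pauliX l) := by
  change _ = _
  revert k l
  decide +kernel

theorem commute_pauliX_pauliZ {k l : Fin 3} (h : k ≠ l) : Commute (pauliX k) (pauliZ l) := by
  change _ = _
  revert k l
  decide +kernel

theorem commute_pauliZ (k l : Fin 3) : Commute (pauliZ k) (pauliZ l) := by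
  change _ = _
  revert k l
  decide +kernel

/-- The signed Pauli matrices that occur in the Fourier coefficients of `R`. -/
def pauliEntry (k : Fin 3) (i j : Fin 4) : Matrix (Fin 8) (Fin 8) ℤ :=
  !![1, 0, 0, 0; 0, 0, 1, 0; 0, pauliX k, 0, pauliZ k; 0, pauliZ k, 0, -pauliX k] i j

/-- The embedding of the quaternions into three tensor factors that intertwines the conjugations
with products of Pauli matrices. -/
def quatIntertwiner : Matrix (Fin 8) (Fin 4) ℤ :=
  !![-1, 0, 0, 0; 0, 0, 1, 0; 0, 0, 0, 1; 0, 1, 0, 0;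
     0, 1, 0, 0; 0, 0, 0, -1; 0, 0, 1, 0; 1, 0, 0, 0]

/-- This gives the intertwiner a left inverse up to the factor 2, which allows it to be cancelled at
the end. -/
theorem transpose_quatIntertwiner_mul :
    quatIntertwiner.transpose * quatIntertwiner = (2 : ℤ) • 1 := by
  decide +kernel

/-- The positions of the nonzero Fourier coefficients of `R`. -/
def pauliSupport (i j : Fin 4) : Bool :=
  !![true, false, false, false; false, false, true, false;
     false, true, false, true; false, true, false, true] i j

/-- On the embedded quaternions the product depends only on the endpoints i and l of the path, not
on j and k. So the scalar weights of all paths can be collected in front of one matrix. -/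
theorem pauliEntry_mul_quatIntertwiner (i j k l : Fin 4) (h₁ : pauliSupport i j = true)
    (h₂ : pauliSupport j k = true) (h₃ : pauliSupport k l = true) :
    pauliEntry 0 i j * (pauliEntry 1 j k * (pauliEntry 2 k l * quatIntertwiner)) =
      quatIntertwiner * quatConj i l := by
  revert i j k l
  decide +kernel

/-! ### The main result -/

/-! ### From Pauli matrices to the quaternion model -/

section Intertwiner

variable {m n : Type*} [Fintype m] [Fintype n] [DecidableEq m] [DecidableEq n]
  {N : Matrix (Fin 4) (Fin 4) (Matrix m m ℂ)} {V : Matrix (Fin 4) (Fin 4) (Matrix n n ℂ)}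
  {J : Matrix m n ℂ}

theorem fourier_mul_intertwiner (h : ∀ i j, N i j * J = J * V i j) (i j : Fin 4) :
    fourier N i j * J = J * fourier V i j := by
  simp only [fourier_apply, Matrix.smul_mul, Matrix.mul_smul, Matrix.sum_mul, Matrix.mul_sum, h]

theorem eval_mul_intertwiner (h : ∀ i j, N i j * J = J * V i j)
    (P : FreeAlgebra ℂ (Fin 4 × Fin 4)) : eval N P * J = J * eval V P := by
  unfold eval
  induction P using FreeAlgebra.induction with
  | grade0 c =>
    rw [AlgHom.commutes, AlgHom.commutes]
    simp only [Algebra.algebraMap_eq_smul_one, Matrix.smul_mul, Matrix.mul_smul,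
      Matrix.one_mul, Matrix.mul_one]
  | grade1 ij => simp only [FreeAlgebra.lift_ι_apply, h]
  | mul P Q hP hQ => rw [map_mul, map_mul, Matrix.mul_assoc, hQ, ← Matrix.mul_assoc, hP,
      Matrix.mul_assoc]
  | add P Q hP hQ => rw [map_add, map_add, Matrix.add_mul, hP, hQ, Matrix.mul_add]

end Intertwiner

/-- The Fourier coefficients of the image of `R` under the representation by the Pauli matrices in
the `k`-th tensor factor. -/
def pauliModel (k : Fin 3) (c s : ℝ) : Matrix (Fin 4) (Fin 4) (Matrix (Fin 8) (Fin 8) ℂ) :=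
  pauliFourier c s ((pauliX k).map Int.cast) ((pauliZ k).map Int.cast)

/-- At (3, 3) the rotation has −c and `pauliEntry` has −X; the signs cancel to the entry cX of
`pauliFourier`. -/
theorem pauliModel_apply (k : Fin 3) (c s : ℝ) (i j : Fin 4) : pauliModel k c s i j =
      quatRotation c s i j • (pauliEntry k i j).map (Int.cast : ℤ → ℂ) := by
  have h1 : (1 : Matrix (Fin 8) (Fin 8) ℤ).map (Int.cast : ℤ → ℂ) = 1 := by
    simp
  have h2 : (-pauliX k).map (Int.cast : ℤ → ℂ) = -(pauliX k).map (Int.cast : ℤ → ℂ) := by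
    ext
    simp
  fin_cases i <;> fin_cases j <;> simp [pauliModel, pauliFourier, quatRotation, pauliEntry, h1, h2]

theorem quatRotation_eq_zero {i j : Fin 4} (h : pauliSupport i j ≠ true) (c s : ℝ) :
    quatRotation c s i j = 0 := by
  revert h
  fin_cases i <;> fin_cases j <;> simp [pauliSupport, quatRotation]

/-- Both sides are sums over paths i → j → k → l. Paths outside the support have weight 0, and the
others all contribute the same matrix, so the weights sum to the (i, l) entry of the product of the
rotations. -/
theorem pauliModel_mul_quatIntertwiner (c s : Fin 3 → ℝ) (i l : Fin 4) :
    (pauliModel 0 (c 0) (s 0) * pauliModel 1 (c 1) (s 1) * pauliModel 2 (c 2) (s 2)) i l *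
        quatIntertwiner.map (Int.cast : ℤ → ℂ) =
    quatIntertwiner.map (Int.cast : ℤ → ℂ) * untwist (quatRotation (c 0) (s 0) *
      quatRotation (c 1) (s 1) * quatRotation (c 2) (s 2)) i l := by
  have h1 : ∀ j k, (quatRotation (c 0) (s 0) i j * quatRotation (c 1) (s 1) j k *
      quatRotation (c 2) (s 2) k l) • ((pauliEntry 0 i j).map (Int.cast : ℤ → ℂ) *
        (pauliEntry 1 j k).map (Int.cast : ℤ → ℂ) * (pauliEntry 2 k l).map (Int.cast : ℤ → ℂ) *
        quatIntertwiner.map (Int.cast : ℤ → ℂ)) =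
      (quatRotation (c 0) (s 0) i j * quatRotation (c 1) (s 1) j k *
      quatRotation (c 2) (s 2) k l) • (quatIntertwiner.map (Int.cast : ℤ → ℂ) *
        (quatConj i l).map (Int.cast : ℤ → ℂ)) := fun j k => by
    by_cases h₁ : pauliSupport i j = true
    · by_cases h₂ : pauliSupport j k = true
      · by_cases h₃ : pauliSupport k l = true
        · have h := congrArg (fun G : Matrix (Fin 8) (Fin 4) ℤ => G.map (Int.castRingHom ℂ))
            (pauliEntry_mul_quatIntertwiner i j k l h₁ h₂ h₃)
          simp only [Matrix.map_mul] at h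
          rw [Matrix.mul_assoc, Matrix.mul_assoc]
          exact congrArg _ h
        · rw [quatRotation_eq_zero h₃, mul_zero, zero_smul, zero_smul]
      · rw [quatRotation_eq_zero h₂, mul_zero, zero_mul, zero_smul, zero_smul]
    · rw [quatRotation_eq_zero h₁, zero_mul, zero_mul, zero_smul, zero_smul]
  have h2 : ∀ x : ℂ, tens (quatConj i l) x = x • (quatConj i l).map (Int.cast : ℤ → ℂ) :=
      fun x => by
      ext r t
      simp [tens_apply, mul_comm]
  simp only [untwist_apply, h2, Matrix.mul_apply (M := _ * _),
    Matrix.mul_apply (M := pauliModel _ _ _),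
    Matrix.mul_apply (M := quatRotation _ _), pauliModel_apply, Finset.sum_mul,
    smul_mul_smul_comm, Matrix.sum_mul, Matrix.smul_mul, h1, Finset.sum_smul]
  simp only [Matrix.mul_sum, Matrix.mul_smul]

-- The representation on ℂ^8 kills P, and the intertwiner J carries this to J · P(`quatModel` x) =
-- 0; then JᵀJ = 2 removes J.
open scoped ComplexOrder in
theorem eval_quatModel_eq_zero {P : FreeAlgebra ℂ (Fin 4 × Fin 4)} (hP : eval M P = 0)
    {c s : Fin 3 → ℝ} (hcs : ∀ k, c k ^ 2 + s k ^ 2 = 1) :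
    eval (quatModel (quatRotation (c 0) (s 0) * quatRotation (c 1) (s 1) *
      quatRotation (c 2) (s 2))) P = 0 := by
  let e : Matrix (Fin 8) (Fin 8) ℂ ≃⋆ₐ[ℂ] CStarMatrix (Fin 8) (Fin 8) ℂ :=
    CStarMatrix.ofMatrixStarAlgEquiv
  let cast : Matrix (Fin 8) (Fin 8) ℤ →+* Matrix (Fin 8) (Fin 8) ℂ :=
    (Int.castRingHom ℂ).mapMatrix
  let κ : Matrix (Fin 8) (Fin 8) ℤ →+* CStarMatrix (Fin 8) (Fin 8) ℂ :=
    (e.toRingEquiv : Matrix (Fin 8) (Fin 8) ℂ →+* CStarMatrix (Fin 8) (Fin 8) ℂ).comp cast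
  have hκ : ∀ G : Matrix (Fin 8) (Fin 8) ℤ, G.transpose = G → star (κ G) = κ G := fun G hG => by
    change star (e (cast G)) = e (cast G)
    rw [← map_star]
    congr 1
    ext i j
    have := congrFun (congrFun hG i) j
    rw [Matrix.transpose_apply] at this
    simp [cast, Matrix.star_apply, this]
  have h1 := eval_fourier_pauliFourier (X := fun k => κ (pauliX k)) (Z := fun k => κ (pauliZ k))
    (fun k => ⟨by rw [← map_mul, pauliX_mul_self, map_one],
      by rw [← map_mul, pauliZ_mul_self, map_one],
      by rw [← map_mul, ← map_mul, pauliZ_mul_pauliX, map_neg],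
      hκ _ (pauliX_transpose k), hκ _ (pauliZ_transpose k)⟩)
    (fun k l _ => (commute_pauliX k l).map κ) (fun k l h => (commute_pauliX_pauliZ h).map κ)
    (fun k l _ => (commute_pauliZ k l).map κ) hcs hP
  let θ : CStarMatrix (Fin 8) (Fin 8) ℂ →ₐ[ℂ] Matrix (Fin 8) (Fin 8) ℂ :=
    (e.symm : CStarMatrix (Fin 8) (Fin 8) ℂ →⋆ₐ[ℂ] Matrix (Fin 8) (Fin 8) ℂ).toAlgHom
  have h2 : ∀ k c s, (pauliFourier c s (κ (pauliX k)) (κ (pauliZ k))).map θ =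
      pauliModel k c s := fun k c s => by
    rw [pauliFourier_map]
    rfl
  set W := pauliFourier (c 0) (s 0) (κ (pauliX 0)) (κ (pauliZ 0)) *
    pauliFourier (c 1) (s 1) (κ (pauliX 1)) (κ (pauliZ 1)) *
    pauliFourier (c 2) (s 2) (κ (pauliX 2)) (κ (pauliZ 2)) with hW
  have h4 : fourier (W.map θ) = (fourier W).map θ := fourier_map θ.toLinearMap W
  have h3 : eval (fourier (W.map θ)) P = 0 := by rw [h4, eval_map, h1, map_zero]
  rw [hW, Matrix.map_mul, Matrix.map_mul, h2, h2, h2] at h3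
  have h6 := eval_mul_intertwiner
    (fourier_mul_intertwiner (pauliModel_mul_quatIntertwiner c s)) P
  rw [h3, Matrix.zero_mul] at h6
  have h7 : (quatIntertwiner.map (Int.cast : ℤ → ℂ)).transpose *
      quatIntertwiner.map (Int.cast : ℤ → ℂ) = (2 : ℂ) • 1 := by
    have h := congrArg (fun G : Matrix (Fin 4) (Fin 4) ℤ => G.map (Int.castRingHom ℂ))
      transpose_quatIntertwiner_mul
    simp only [Matrix.map_mul] at h
    refine Eq.trans h ?_
    ext i j
    rw [Matrix.map_apply, Matrix.smul_apply, Matrix.smul_apply]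
    by_cases hij : i = j <;> simp [hij, Matrix.one_apply]
  have h8 := congrArg (fun G => (quatIntertwiner.map (Int.cast : ℤ → ℂ)).transpose * G) h6
  simp only [Matrix.mul_zero, ← Matrix.mul_assoc, h7, Matrix.smul_mul, Matrix.one_mul] at h8
  exact (smul_eq_zero.1 h8.symm).resolve_left two_ne_zero

/-- A noncommutative polynomial that vanishes at `M` vanishes at the universal magic unitary. -/
theorem eval_u_eq_zero {P : FreeAlgebra ℂ (Fin 4 × Fin 4)} (hP : eval M P = 0) :
    eval (u 4) P = 0 := by
  refine eval_eq_zero_of_forall_quatEnd (isMagic_u 4) fun x hx hs => ?_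
  obtain ⟨c₁, s₁, c₂, s₂, c₃, s₃, h₁, h₂, h₃, rfl⟩ := hx.exists_eq_quatRotation_mul hs
  refine eval_quatModel_eq_zero hP (c := ![c₁, c₂, c₃]) (s := ![s₁, s₂, s₃]) fun k => ?_
  fin_cases k
  exacts [h₁, h₂, h₃]

end QPerm

end

theorem corollary5p1 (P : FreeAlgebra ℂ (Fin 4 × Fin 4)) (hP : QPerm.degree P ≤ 50) :
    QPerm.eval QPerm.M P = 0 ↔ QPerm.eval (QPerm.u 4) P = 0 :=
  ⟨QPerm.eval_u_eq_zero, QPerm.eval_eq_zero_of_isMagic QPerm.isMagic_M⟩
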